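/- Let $\kappa,\tau\in\mathbb R$ and let $\mathcal R(\kappa,\tau)=\{(x,y,z)\in\mathbb R^3: 4+\kappa(x^2+y^2)>0\}$ carry the metric $$g=\sigma^2(dx^2+dy^2)+\big(\sigma\tau(y\,dx-x\,dy)+dz\big)^2,\qquad \sigma=\frac{4}{4+\kappa(x^2+y^2)},$$ the standard model of the homogeneous space $\mathbb E(\kappa,\tau)$. Let $r>0$ with $4+\kappa r^2>0$, and let $L>0$. Let $$\mathsf C_\alpha(L)=\{(x,y,z): x^2+y^2=r^2,\ 0\le z\le L\}$$ be the truncated vertical cylinder over the circle $\alpha$ of coordinate radius $r$ about the origin, with unit normal $N$, second fundamental form $A(X,Y)=g(\overline\nabla_XY,N)$ and constant mean curvature $H=\frac12\operatorname{tr}A$. Its radius $\rho$ (the geodesic radius of $\alpha$) is $\frac{2}{\sqrt{-\kappa}}\operatorname{arctanh}\frac{r\sqrt{-\kappa}}2$ if $\kappa<0$, $r$ if $\kappa=0$, and $\frac{2}{\sqrt{\kappa}}\arctan\frac{r\sqrt{\kappa}}2$ if $\kappa>0$. Put $$L_0=\begin{cases}\frac{2\pi}{-\kappa}\sinh(\rho\sqrt{-\kappa})\sqrt{-\kappa+4\tau^2\tanh^2\frac{\rho\sqrt{-\kappa}}2}&\kappa<0,\\[2pt]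 2\pi\rho\sqrt{1+\tau^2\rho^2}&\kappa=0,\\[2pt] \frac{2\pi}{\kappa}\sin(\rho\sqrt{\kappa})\sqrt{\kappa+4\tau^2\tan^2\frac{\rho\sqrt{\kappa}}2}&\kappa>0.\end{cases}$$ Consider smooth variations $\Sigma_\varepsilon$ of $\Sigma_0=\mathsf C_\alpha(L)$ that fix the boundary, have variation field $uN$ at $\varepsilon=0$, and commute with the rotations about the $z$-axis (axially symmetric variations). Let $\mathcal A(\varepsilon)$ be the area of $\Sigma_\varepsilon$ and $\mathcal V(\varepsilon)$ the signed volume swept out between $\Sigma_0$ and $\Sigma_\varepsilon$, with the sign for which $\mathcal V'(0)=\int u$. Let also $$Q[u]=-\int_{\mathsf C_\alpha(L)}u\big(\Delta u+|A|^2u+\mathrm{Ric}(N)u\big)$$ for smooth rotationally invariant functions $u$ on $\mathsf C_\alpha(L)$ that vanish on the boundary. Then: 1. $\mathsf C_\alpha(L)$ is strongly stable for axially symmetric variations if and only if $L\le L_0/2$. This holds both when strongly stable means $(\mathcal A+2H\mathcal V)''(0)\ge0$ for all such variations, and when it means $Q[u]\ge0$ for all such $u$. 2. $\mathsf C_\alpha(L)$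 is stable for axially symmetric variations if and only if $L\le L_0$. This holds both when stable means $\mathcal A''(0)\ge0$ for all such variations that preserve volume ($\mathcal V(\varepsilon)=0$ for all $\varepsilon$), and when it means $Q[u]\ge0$ for all such $u$ with $\int_{\mathsf C_\alpha(L)}u=0$. -/

import Mathlib

open Set
open scoped ContDiff

noncomputable section

namespace EKT

/-! ## The ambient space

A point of `Fin 3 → ℝ` is its triple of coordinates `(x, y, z)`, a tangent vector its triple of
components with respect to `∂x, ∂y, ∂z`. -/

/-- The open set of `ℝ³` carrying the metric of `𝔼(κ, τ)`: all of `ℝ³` when `κ ≥ 0`, and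
`{x² + y² < 4 / (-κ)}` when `κ < 0`. -/
def model (κ : ℝ) : Set (Fin 3 → ℝ) := {p | 0 < 4 + κ * (p 0 ^ 2 + p 1 ^ 2)}

/-- The conformal factor `σ = 4 / (4 + κ (x² + y²))`. -/
def sigma (κ : ℝ) (p : Fin 3 → ℝ) : ℝ := 4 / (4 + κ * (p 0 ^ 2 + p 1 ^ 2))

/-- The metric `σ² (dx² + dy²) + (σ τ (y dx - x dy) + dz)²` at `p`, evaluated on `v, w`. -/
def metric (κ τ : ℝ) (p v w : Fin 3 → ℝ) : ℝ :=
  sigma κ p ^ 2 * (v 0 * w 0 + v 1 * w 1)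
    + (sigma κ p * τ * (p 1 * v 0 - p 0 * v 1) + v 2)
      * (sigma κ p * τ * (p 1 * w 0 - p 0 * w 1) + w 2)

/-- The `i`-th partial derivative of a function of `n` real variables. -/
def pd {n : ℕ} {F : Type*} [NormedAddCommGroup F] [NormedSpace ℝ F]
    (i : Fin n) (f : (Fin n → ℝ) → F) (p : Fin n → ℝ) : F :=
  fderiv ℝ f p (Pi.single i 1)

/-- The matrix `(g_ij)` of the metric in the coordinates `(x, y, z)`. -/
def metricMatrix (κ τ : ℝ) (p : Fin 3 → ℝ) : Matrix (Fin 3) (Fin 3) ℝ :=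
  Matrix.of fun i j => metric κ τ p (Pi.single i 1) (Pi.single j 1)

/-- The Christoffel symbol `Γᵏ_ij` of the Levi-Civita connection. -/
def christoffel (κ τ : ℝ) (k i j : Fin 3) (p : Fin 3 → ℝ) : ℝ :=
  1 / 2 * ∑ l, (metricMatrix κ τ p)⁻¹ k l *
    (pd i (fun q => metricMatrix κ τ q j l) p + pd j (fun q => metricMatrix κ τ q i l) p
      - pd l (fun q => metricMatrix κ τ q i j) p)

/-- The components `R_jk` of the Ricci tensor (positive on round spheres). -/
def ricci (κ τ : ℝ) (j k : Fin 3) (p : Fin 3 → ℝ) : ℝ :=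
  ∑ i, (pd i (christoffel κ τ i j k) p - pd j (christoffel κ τ i i k) p
    + ∑ l, (christoffel κ τ i i l p * christoffel κ τ l j k p
      - christoffel κ τ i j l p * christoffel κ τ l i k p))

/-- The Ricci curvature `Ric(v) = Ric(v, v)` at `p`. -/
def ricciCurvature (κ τ : ℝ) (p v : Fin 3 → ℝ) : ℝ :=
  ∑ j, ∑ k, ricci κ τ j k p * v j * v k

/-! ## Geometry of a parametrized surface

`X : (Fin 2 → ℝ) → (Fin 3 → ℝ)` is a parametrization with parameters `q = (s, t)`. -/

/-- The first fundamental form of `X`. -/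
def firstForm (κ τ : ℝ) (X : (Fin 2 → ℝ) → (Fin 3 → ℝ)) (q : Fin 2 → ℝ) :
    Matrix (Fin 2) (Fin 2) ℝ :=
  Matrix.of fun i j => metric κ τ (X q) (pd i X q) (pd j X q)

/-- The density `√det(g_ij)` of the area element of `X`. -/
def areaDensity (κ τ : ℝ) (X : (Fin 2 → ℝ) → (Fin 3 → ℝ)) (q : Fin 2 → ℝ) : ℝ :=
  Real.sqrt (firstForm κ τ X q).det

/-- The covariant derivative `∇_{X_i} X_j` along `X`. -/
def covDeriv (κ τ : ℝ) (X : (Fin 2 → ℝ) → (Fin 3 → ℝ)) (i j : Fin 2) (q : Fin 2 → ℝ) :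
    Fin 3 → ℝ :=
  fun k => pd i (pd j X) q k
    + ∑ a, ∑ b, christoffel κ τ k a b (X q) * pd i X q a * pd j X q b

/-- The second fundamental form of `X` with respect to the unit normal `N`. -/
def secondForm (κ τ : ℝ) (X N : (Fin 2 → ℝ) → (Fin 3 → ℝ)) (q : Fin 2 → ℝ) :
    Matrix (Fin 2) (Fin 2) ℝ :=
  Matrix.of fun i j => metric κ τ (X q) (covDeriv κ τ X i j q) (N q)

/-- The squared norm `|A|² = g^{ik} g^{jl} A_ij A_kl` of the second fundamental form. -/
def secondFormNormSq (κ τ : ℝ) (X N : (Fin 2 → ℝ) → (Fin 3 → ℝ)) (q : Fin 2 → ℝ) : ℝ :=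
  ∑ i, ∑ j, ∑ k, ∑ l, (firstForm κ τ X q)⁻¹ i k * (firstForm κ τ X q)⁻¹ j l
    * secondForm κ τ X N q i j * secondForm κ τ X N q k l

/-- The mean curvature `H = (1/2) g^{ij} A_ij` of `X` with respect to the unit normal `N`. -/
def meanCurvature (κ τ : ℝ) (X N : (Fin 2 → ℝ) → (Fin 3 → ℝ)) (q : Fin 2 → ℝ) : ℝ :=
  1 / 2 * ∑ i, ∑ j, (firstForm κ τ X q)⁻¹ i j * secondForm κ τ X N q i j

/-- The Laplace-Beltrami operator of the induced metric of `X`. -/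
def laplacian (κ τ : ℝ) (X : (Fin 2 → ℝ) → (Fin 3 → ℝ)) (u : (Fin 2 → ℝ) → ℝ)
    (q : Fin 2 → ℝ) : ℝ :=
  1 / areaDensity κ τ X q * ∑ i, ∑ j,
    pd i (fun p => areaDensity κ τ X p * (firstForm κ τ X p)⁻¹ i j * pd j u p) q

/-- The Jacobi operator `Δ + |A|² + Ric(N)`. -/
def jacobi (κ τ : ℝ) (X N : (Fin 2 → ℝ) → (Fin 3 → ℝ)) (u : (Fin 2 → ℝ) → ℝ)
    (q : Fin 2 → ℝ) : ℝ :=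
  laplacian κ τ X u q + secondFormNormSq κ τ X N q * u q + ricciCurvature κ τ (X q) (N q) * u q

/-- The integral of `f` over the piece `[0, a] × [0, L]` of `X`, with respect to area. -/
def surfaceIntegral (κ τ a L : ℝ) (X : (Fin 2 → ℝ) → (Fin 3 → ℝ)) (f : (Fin 2 → ℝ) → ℝ) : ℝ :=
  ∫ s in (0 : ℝ)..a, ∫ t in (0 : ℝ)..L, f ![s, t] * areaDensity κ τ X ![s, t]

/-! ## Circular cylinders -/

/-- `R = 4 r / (4 + κ r²)`: the circle of coordinate radius `r` has length `2 π R`. -/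
def bigR (κ r : ℝ) : ℝ := 4 * r / (4 + κ * r ^ 2)

/-- The geodesic radius in `𝕄²(κ)` of the circle of coordinate radius `r` about the origin. -/
def radius (κ r : ℝ) : ℝ :=
  if κ < 0 then 2 / Real.sqrt (-κ) * Real.artanh (r * Real.sqrt (-κ) / 2)
  else if κ = 0 then r
  else 2 / Real.sqrt κ * Real.arctan (r * Real.sqrt κ / 2)

/-- The critical length `L₀`, as a function of `κ`, `τ` and the geodesic radius `ρ`. -/
def criticalLength (κ τ ρ : ℝ) : ℝ :=
  if κ < 0 then
    2 * Real.pi / (-κ) * Real.sinh (ρ * Real.sqrt (-κ))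
      * Real.sqrt (-κ + 4 * τ ^ 2 * Real.tanh (ρ * Real.sqrt (-κ) / 2) ^ 2)
  else if κ = 0 then 2 * Real.pi * ρ * Real.sqrt (1 + τ ^ 2 * ρ ^ 2)
  else
    2 * Real.pi / κ * Real.sin (ρ * Real.sqrt κ)
      * Real.sqrt (κ + 4 * τ ^ 2 * Real.tan (ρ * Real.sqrt κ / 2) ^ 2)

/-- The vertical cylinder over the circle of coordinate radius `r` about the origin. The truncated
cylinder of length `L` is the image of `0 ≤ t ≤ L`, covered once by `0 ≤ s < 2 π R`. -/
def cylinder (κ r : ℝ) (q : Fin 2 → ℝ) : Fin 3 → ℝ :=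
  ![r * Real.cos (q 0 / bigR κ r), r * Real.sin (q 0 / bigR κ r), q 1]

/-- The unit normal `N = cos(s/R) E₁ + sin(s/R) E₂` of the cylinder, where
`E₁ = σ⁻¹ ∂x - τ y ∂z` and `E₂ = σ⁻¹ ∂y + τ x ∂z`. -/
def cylinderNormal (κ τ r : ℝ) (q : Fin 2 → ℝ) : Fin 3 → ℝ :=
  let p := cylinder κ r q
  Real.cos (q 0 / bigR κ r) • ![(sigma κ p)⁻¹, 0, -τ * p 1]
    + Real.sin (q 0 / bigR κ r) • ![0, (sigma κ p)⁻¹, τ * p 0]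

/-- The rotation of angle `θ` about the `z`-axis, an isometry of `𝔼(κ, τ)`. -/
def rotation (θ : ℝ) (p : Fin 3 → ℝ) : Fin 3 → ℝ :=
  ![Real.cos θ * p 0 - Real.sin θ * p 1, Real.sin θ * p 0 + Real.cos θ * p 1, p 2]

/-! ## Stability -/

/-- The quadratic form `Q[u] = -∫ u (Δu + |A|² u + Ric(N) u)` on the truncated cylinder. -/
def quadForm (κ τ r L : ℝ) (u : (Fin 2 → ℝ) → ℝ) : ℝ :=
  -surfaceIntegral κ τ (2 * Real.pi * bigR κ r) L (cylinder κ r)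
    (fun q => u q * jacobi κ τ (cylinder κ r) (cylinderNormal κ τ r) u q)

/-- Smooth functions on the truncated cylinder of length `L` which vanish on its boundary and are
invariant under the rotations about the axis. -/
structure IsAxialTest (L : ℝ) (u : (Fin 2 → ℝ) → ℝ) : Prop where
  smooth : ContDiff ℝ ∞ u
  axial : ∀ s c t : ℝ, u ![s + c, t] = u ![s, t]
  bottom : ∀ s : ℝ, u ![s, 0] = 0
  top : ∀ s : ℝ, u ![s, L] = 0

/-- `Q[u] ≥ 0` for all admissible `u`, without restriction on the mean. -/
def FormStronglyStable (κ τ r L : ℝ) : Prop :=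
  ∀ u : (Fin 2 → ℝ) → ℝ, IsAxialTest L u → 0 ≤ quadForm κ τ r L u

/-- `Q[u] ≥ 0` for all admissible `u` with mean zero. -/
def FormStable (κ τ r L : ℝ) : Prop :=
  ∀ u : (Fin 2 → ℝ) → ℝ, IsAxialTest L u →
    surfaceIntegral κ τ (2 * Real.pi * bigR κ r) L (cylinder κ r) u = 0 →
      0 ≤ quadForm κ τ r L u

/-- An axially symmetric normal variation `{Σ_e : -δ < e < δ}` of the truncated cylinder, with fixed
boundary: `Ψ e` parametrizes `Σ_e`. -/
structure IsAxialVariation (κ τ r L δ : ℝ) (Ψ : ℝ → (Fin 2 → ℝ) → (Fin 3 → ℝ)) : Prop where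
  smooth : ContDiffOn ℝ ∞ (fun p : ℝ × (Fin 2 → ℝ) => Ψ p.1 p.2) (Ioo (-δ) δ ×ˢ univ)
  mem_model : ∀ e ∈ Ioo (-δ) δ, ∀ s : ℝ, ∀ t ∈ Icc 0 L, Ψ e ![s, t] ∈ model κ
  start : ∀ q, Ψ 0 q = cylinder κ r q
  bottom : ∀ e ∈ Ioo (-δ) δ, ∀ s : ℝ, Ψ e ![s, 0] = cylinder κ r ![s, 0]
  top : ∀ e ∈ Ioo (-δ) δ, ∀ s : ℝ, Ψ e ![s, L] = cylinder κ r ![s, L]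
  normal : ∀ s : ℝ, ∀ t ∈ Icc 0 L, ∃ a : ℝ,
    deriv (fun e => Ψ e ![s, t]) 0 = a • cylinderNormal κ τ r ![s, t]
  axial : ∀ e ∈ Ioo (-δ) δ, ∀ s c t : ℝ,
    Ψ e ![s + c, t] = rotation (c / bigR κ r) (Ψ e ![s, t])

/-- The area of `Σ_e`. -/
def area (κ τ r L : ℝ) (Ψ : ℝ → (Fin 2 → ℝ) → (Fin 3 → ℝ)) (e : ℝ) : ℝ :=
  surfaceIntegral κ τ (2 * Real.pi * bigR κ r) L (Ψ e) (fun _ => 1)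

/-- The signed volume swept out between `Σ_0` and `Σ_e`: the integral over `[0, e] × Σ` of the
pull-back under `Ψ` of the Riemannian volume form. -/
def sweptVolume (κ τ r L : ℝ) (Ψ : ℝ → (Fin 2 → ℝ) → (Fin 3 → ℝ)) (e : ℝ) : ℝ :=
  ∫ h in (0 : ℝ)..e, ∫ s in (0 : ℝ)..(2 * Real.pi * bigR κ r), ∫ t in (0 : ℝ)..L,
    Real.sqrt (metricMatrix κ τ (Ψ h ![s, t])).det *
      (Matrix.of ![deriv (fun x => Ψ x ![s, t]) h, pd 0 (Ψ h) ![s, t], pd 1 (Ψ h) ![s, t]]).det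

/-- Stability for axially symmetric variations, in variational form: `A''(0) ≥ 0` for every volume preserving axially
symmetric normal variation with fixed boundary. -/
def Stable (κ τ r L : ℝ) : Prop :=
  ∀ (δ : ℝ) (Ψ : ℝ → (Fin 2 → ℝ) → (Fin 3 → ℝ)), 0 < δ → IsAxialVariation κ τ r L δ Ψ →
    (∀ e ∈ Ioo (-δ) δ, sweptVolume κ τ r L Ψ e = 0) →
      0 ≤ iteratedDeriv 2 (area κ τ r L Ψ) 0

/-- Strong stability for axially symmetric variations, in variational form: without the volume
constraint one takes the second variation of `A + 2 H V`, where `H` is the constant mean curvature.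
Here `A' (0) = -2 H ∫ u` and `V' (0) = ∫ u` for the variation field `u N`, so that the cylinder is
a critical point of `A + 2 H V` for all variations with fixed boundary. -/
def StronglyStable (κ τ r L : ℝ) : Prop :=
  ∃ H : ℝ, (∀ q, meanCurvature κ τ (cylinder κ r) (cylinderNormal κ τ r) q = H) ∧
    ∀ (δ : ℝ) (Ψ : ℝ → (Fin 2 → ℝ) → (Fin 3 → ℝ)), 0 < δ → IsAxialVariation κ τ r L δ Ψ →
      0 ≤ iteratedDeriv 2 (fun e => area κ τ r L Ψ e + 2 * H * sweptVolume κ τ r L Ψ e) 0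

end EKT

end

noncomputable section

namespace EKT

/-! ## Partial derivatives -/

section PartialDerivatives

variable {n : ℕ}

/-! Write R for `bigR κ r`, so that 2πR is the length of α, and K = 1 + τ²r². In the parameters (s,
t) the first fundamental form of the cylinder is constant with determinant 1, and |A|² + Ric(N) is
the constant 1/R². On a rotationally invariant function u = v(t), Q[u] is therefore 2πR times the
one-dimensional form ∫ (K v'² - v²/R²) (`quadForm_eq`). With Dirichlet conditions the best constant
in ∫ v'² ≥ b² ∫ v² is b = π/L, and with the extra condition ∫ v = 0 it is b = 2π/L
(`integral_sq_le_of_dirichlet`, `integral_sq_le_of_mean_zero`); sin(πt/L) and sin(2πt/L) show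
sharpness (`profileForm_sin_neg`). The form is thus nonnegative exactly for L ≤ πR√K, respectively L
≤ 2πR√K, and double-angle formulas identify 2πR√K with L₀ (`criticalLength_eq`).

For the variational notions, a surface of revolution is described by its height z and by Y, where πY
is the area enclosed by the orbit of a point. Area is then 2π ∫ √W for an explicit W, and the swept
volume has density π(Y_e z_t - z_e Y_t). The second derivative of A + 2HV at 0 is π/(2R) times the
same one-dimensional form, evaluated at a = Y_e (`IsAxialVariation.second_variation`): the terms in
Y_ee cancel because the cylinder has mean curvature H, and z_eet integrates to zero because the
boundary is fixed. Conversely, Y = rR + e v(t) with z = t realises a prescribed field v with |v| ≤ 1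
(`areaVariation`). Its volume is linear in e, so a field of mean zero gives a variation that
preserves volume exactly, without any correction by an implicit function argument. -/

lemma pd_const (i : Fin n) (c : ℝ) (p : Fin n → ℝ) : pd i (fun _ => c) p = 0 := by
  simp [pd]

lemma pd_coord (i j : Fin n) (p : Fin n → ℝ) :
    pd i (fun q : Fin n → ℝ => q j) p = if j = i then 1 else 0 := by
  have h : HasFDerivAt (fun q : Fin n → ℝ => q j)
      (ContinuousLinearMap.proj (R := ℝ) (φ := fun _ : Fin n => ℝ) j) p :=
    (ContinuousLinearMap.proj (R := ℝ) (φ := fun _ : Fin n => ℝ) j).hasFDerivAt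
  simp [pd, h.fderiv, Pi.single_apply]

lemma pd_add (i : Fin n) {f g : (Fin n → ℝ) → ℝ} {p : Fin n → ℝ}
    (hf : DifferentiableAt ℝ f p) (hg : DifferentiableAt ℝ g p) :
    pd i (fun q => f q + g q) p = pd i f p + pd i g p := by
  simp [pd, fderiv_fun_add hf hg]

lemma pd_sub (i : Fin n) {f g : (Fin n → ℝ) → ℝ} {p : Fin n → ℝ}
    (hf : DifferentiableAt ℝ f p) (hg : DifferentiableAt ℝ g p) :
    pd i (fun q => f q - g q) p = pd i f p - pd i g p := by
  simp [pd, fderiv_fun_sub hf hg]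

lemma pd_neg (i : Fin n) (f : (Fin n → ℝ) → ℝ) (p : Fin n → ℝ) :
    pd i (fun q => -f q) p = -pd i f p := by
  simp [pd, fderiv_fun_neg]

lemma pd_mul (i : Fin n) {f g : (Fin n → ℝ) → ℝ} {p : Fin n → ℝ}
    (hf : DifferentiableAt ℝ f p) (hg : DifferentiableAt ℝ g p) :
    pd i (fun q => f q * g q) p = f p * pd i g p + pd i f p * g p := by
  simp [pd, fderiv_fun_mul hf hg]; ring

lemma pd_pow (i : Fin n) (m : ℕ) {f : (Fin n → ℝ) → ℝ} {p : Fin n → ℝ}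
    (hf : DifferentiableAt ℝ f p) :
    pd i (fun q => f q ^ m) p = m * f p ^ (m - 1) * pd i f p := by
  simp [pd, fderiv_fun_pow m hf]

lemma pd_congr (i : Fin n) {f g : (Fin n → ℝ) → ℝ} {p : Fin n → ℝ}
    (h : f =ᶠ[nhds p] g) : pd i f p = pd i g p := by
  simp [pd, h.fderiv_eq]

end PartialDerivatives

lemma forall_fin_three {P : Fin 3 → Prop} : (∀ i, P i) ↔ P 0 ∧ P 1 ∧ P 2 :=
  ⟨fun h => ⟨h 0, h 1, h 2⟩, fun h i => by
    match i with
    | 0 => exact h.1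
    | 1 => exact h.2.1
    | 2 => exact h.2.2⟩

/-- The triple with entries `a`, `b`, `c`, as a function on `Fin 3`. -/
def triple {α : Type*} (a b c : α) (i : Fin 3) : α :=
  match i with
  | 0 => a
  | 1 => b
  | 2 => c

lemma triple_zero {α : Type*} (a b c : α) : triple a b c 0 = a := rfl

lemma triple_one {α : Type*} (a b c : α) : triple a b c 1 = b := rfl

lemma triple_two {α : Type*} (a b c : α) : triple a b c 2 = c := rfl

/-! ## Curvature of the ambient space -/

section Ambient

variable {κ τ : ℝ} {p : Fin 3 → ℝ}

lemma isOpen_model (κ : ℝ) : IsOpen (model κ) :=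
  isOpen_lt continuous_const (by fun_prop)

lemma sigma_pos (hp : p ∈ model κ) : 0 < sigma κ p := div_pos (by norm_num) hp

lemma sigma_mul (hp : p ∈ model κ) : sigma κ p * (4 + κ * (p 0 ^ 2 + p 1 ^ 2)) = 4 :=
  div_mul_cancel₀ _ (ne_of_gt hp)

@[fun_prop]
lemma differentiableAt_sigma (hp : p ∈ model κ) : DifferentiableAt ℝ (sigma κ) p := by
  unfold sigma
  have : 4 + κ * (p 0 ^ 2 + p 1 ^ 2) ≠ 0 := ne_of_gt hp
  fun_prop (disch := assumption)

/-- Obtained by differentiating the identity σ(4 + κ(x² + y²)) = 4. The result is polynomial in x, y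
and σ, which keeps the curvature computation polynomial. -/
lemma pd_sigma (i : Fin 3) (hp : p ∈ model κ) :
    pd i (sigma κ) p
      = -(κ / 2) * sigma κ p ^ 2
        * (p 0 * (if 0 = i then 1 else 0) + p 1 * (if 1 = i then 1 else 0)) := by
  have h0 : 4 + κ * (p 0 ^ 2 + p 1 ^ 2) ≠ 0 := ne_of_gt hp
  have hd := differentiableAt_sigma hp
  have hs := sigma_mul hp
  have key : pd i (fun q => sigma κ q * (4 + κ * (q 0 ^ 2 + q 1 ^ 2))) p = 0 := by
    rw [pd_congr (g := fun _ => (4 : ℝ)), pd_const]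
    filter_upwards [(isOpen_model κ).mem_nhds hp] with q hq using sigma_mul hq
  simp (disch := fun_prop) only [pd_mul, pd_add, pd_pow, pd_const, pd_coord] at key
  have h4 : sigma κ p = 4 / (4 + κ * (p 0 ^ 2 + p 1 ^ 2)) := rfl
  have : pd i (sigma κ) p = pd i (sigma κ) p * (4 + κ * (p 0 ^ 2 + p 1 ^ 2)) * (sigma κ p / 4) := by
    rw [h4]; field_simp
  rw [this]
  linear_combination (sigma κ p / 4) * key

/-- The entries of the metric as polynomials in `x`, `y` and `σ`. -/
def metricEntry (κ τ : ℝ) (i j : Fin 3) (p : Fin 3 → ℝ) : ℝ :=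
  triple
    (triple (sigma κ p ^ 2 + sigma κ p ^ 2 * τ ^ 2 * p 1 ^ 2) (-(sigma κ p ^ 2 * τ ^ 2 * p 0 * p 1))
      (sigma κ p * τ * p 1))
    (triple (-(sigma κ p ^ 2 * τ ^ 2 * p 0 * p 1)) (sigma κ p ^ 2 + sigma κ p ^ 2 * τ ^ 2 * p 0 ^ 2)
      (-(sigma κ p * τ * p 0)))
    (triple (sigma κ p * τ * p 1) (-(sigma κ p * τ * p 0)) 1) i j

lemma metricMatrix_apply (κ τ : ℝ) (p : Fin 3 → ℝ) (i j : Fin 3) :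
    metricMatrix κ τ p i j = metricEntry κ τ i j p := by
  revert i j
  simp only [forall_fin_three, metricEntry, triple_zero, triple_one, triple_two, metricMatrix,
    Matrix.of_apply, metric, Pi.single_apply, Fin.reduceEq, reduceIte]
  refine ⟨⟨?_, ?_, ?_⟩, ⟨?_, ?_, ?_⟩, ⟨?_, ?_, ?_⟩⟩ <;> ring

lemma metricMatrix_det (κ τ : ℝ) (p : Fin 3 → ℝ) :
    (metricMatrix κ τ p).det = sigma κ p ^ 4 := by
  simp only [Matrix.det_fin_three, metricMatrix_apply, metricEntry, triple_zero, triple_one,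
    triple_two]
  ring

/-- The entries of the inverse of the metric. -/
def metricInvEntry (κ τ : ℝ) (i j : Fin 3) (p : Fin 3 → ℝ) : ℝ :=
  triple
    (triple ((sigma κ p)⁻¹ ^ 2) 0 (-(τ * p 1 * (sigma κ p)⁻¹)))
    (triple 0 ((sigma κ p)⁻¹ ^ 2) (τ * p 0 * (sigma κ p)⁻¹))
    (triple (-(τ * p 1 * (sigma κ p)⁻¹)) (τ * p 0 * (sigma κ p)⁻¹)
      (1 + τ ^ 2 * (p 0 ^ 2 + p 1 ^ 2))) i j

lemma metricMatrix_inv_apply (hp : p ∈ model κ) (i j : Fin 3) :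
    (metricMatrix κ τ p)⁻¹ i j = metricInvEntry κ τ i j p := by
  suffices h : (metricMatrix κ τ p)⁻¹ = Matrix.of fun i j => metricInvEntry κ τ i j p by
    rw [h, Matrix.of_apply]
  apply Matrix.inv_eq_right_inv
  have := (sigma_pos hp).ne'
  rw [← Matrix.ext_iff]
  simp only [forall_fin_three, Matrix.mul_apply, Fin.sum_univ_three, metricMatrix_apply,
    Matrix.of_apply, metricEntry, metricInvEntry, triple_zero, triple_one, triple_two,
    Matrix.one_apply, Fin.reduceEq, reduceIte]
  refine ⟨⟨?_, ?_, ?_⟩, ⟨?_, ?_, ?_⟩, ⟨?_, ?_, ?_⟩⟩ <;> field_simp <;> ring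

/-- The derivatives `∂ᵢ g_jl` of the metric. -/
def metricPartial (κ τ : ℝ) (i j l : Fin 3) (p : Fin 3 → ℝ) : ℝ :=
  triple
    (triple
      (triple (-(κ * p 0 * sigma κ p ^ 3) * (1 + τ ^ 2 * p 1 ^ 2))
        (sigma κ p ^ 2 * τ ^ 2 * p 1 * (κ * p 0 ^ 2 * sigma κ p - 1))
        (-(κ / 2 * τ) * p 0 * p 1 * sigma κ p ^ 2))
      (triple (sigma κ p ^ 2 * τ ^ 2 * p 1 * (κ * p 0 ^ 2 * sigma κ p - 1))
        (2 * p 0 * sigma κ p ^ 2 * τ ^ 2 - κ * p 0 * sigma κ p ^ 3 * (1 + τ ^ 2 * p 0 ^ 2))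
        (τ * sigma κ p * (κ / 2 * p 0 ^ 2 * sigma κ p - 1)))
      (triple (-(κ / 2 * τ) * p 0 * p 1 * sigma κ p ^ 2)
        (τ * sigma κ p * (κ / 2 * p 0 ^ 2 * sigma κ p - 1)) 0))
    (triple
      (triple (2 * p 1 * sigma κ p ^ 2 * τ ^ 2 - κ * p 1 * sigma κ p ^ 3 * (1 + τ ^ 2 * p 1 ^ 2))
        (sigma κ p ^ 2 * τ ^ 2 * p 0 * (κ * p 1 ^ 2 * sigma κ p - 1))
        (-(τ * sigma κ p) * (κ / 2 * p 1 ^ 2 * sigma κ p - 1)))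
      (triple (sigma κ p ^ 2 * τ ^ 2 * p 0 * (κ * p 1 ^ 2 * sigma κ p - 1))
        (-(κ * p 1 * sigma κ p ^ 3) * (1 + τ ^ 2 * p 0 ^ 2))
        (κ / 2 * τ * p 0 * p 1 * sigma κ p ^ 2))
      (triple (-(τ * sigma κ p) * (κ / 2 * p 1 ^ 2 * sigma κ p - 1))
        (κ / 2 * τ * p 0 * p 1 * sigma κ p ^ 2) 0))
    (triple (triple 0 0 0) (triple 0 0 0) (triple 0 0 0)) i j l

lemma pd_metricMatrix (hp : p ∈ model κ) (i j l : Fin 3) :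
    pd i (fun q => metricMatrix κ τ q j l) p = metricPartial κ τ i j l p := by
  revert i j l
  simp only [metricMatrix_apply, metricEntry, metricPartial, forall_fin_three, triple_zero,
    triple_one, triple_two]
  refine ⟨⟨⟨?_, ?_, ?_⟩, ⟨?_, ?_, ?_⟩, ⟨?_, ?_, ?_⟩⟩, ⟨⟨?_, ?_, ?_⟩, ⟨?_, ?_, ?_⟩, ⟨?_, ?_, ?_⟩⟩,
    ⟨⟨?_, ?_, ?_⟩, ⟨?_, ?_, ?_⟩, ⟨?_, ?_, ?_⟩⟩⟩ <;>
  simp (disch := first | assumption | fun_prop (disch := assumption)) only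
    [pd_mul, pd_add, pd_neg, pd_pow, pd_const, pd_coord, pd_sigma, Fin.reduceEq, reduceIte] <;>
  ring

/-- The Christoffel symbols of `𝔼(κ, τ)` as polynomials in `x`, `y` and `σ`. -/
def christoffelPoly (κ τ : ℝ) (k i j : Fin 3) (p : Fin 3 → ℝ) : ℝ :=
  triple
    (triple
      (triple (-(κ / 2) * p 0 * sigma κ p) ((τ ^ 2 - κ / 2) * p 1 * sigma κ p) 0)
      (triple ((τ ^ 2 - κ / 2) * p 1 * sigma κ p) ((κ / 2 - 2 * τ ^ 2) * p 0 * sigma κ p) τ)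
      (triple 0 τ 0))
    (triple
      (triple ((κ / 2 - 2 * τ ^ 2) * p 1 * sigma κ p) ((τ ^ 2 - κ / 2) * p 0 * sigma κ p) (-τ))
      (triple ((τ ^ 2 - κ / 2) * p 0 * sigma κ p) (-(κ / 2) * p 1 * sigma κ p) 0)
      (triple (-τ) 0 0))
    (triple
      (triple (τ * (κ / 2 - 2 * τ ^ 2) * (p 0 * p 1) * sigma κ p ^ 2)
        (τ * (τ ^ 2 - κ / 4) * (p 0 ^ 2 + -p 1 ^ 2) * sigma κ p ^ 2) (-τ ^ 2 * p 0 * sigma κ p))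
      (triple (τ * (τ ^ 2 - κ / 4) * (p 0 ^ 2 + -p 1 ^ 2) * sigma κ p ^ 2)
        (-(τ * (κ / 2 - 2 * τ ^ 2)) * (p 0 * p 1) * sigma κ p ^ 2) (-τ ^ 2 * p 1 * sigma κ p))
      (triple (-τ ^ 2 * p 0 * sigma κ p) (-τ ^ 2 * p 1 * sigma κ p) 0)) k i j

lemma christoffel_eq (hp : p ∈ model κ) (k i j : Fin 3) :
    christoffel κ τ k i j p = christoffelPoly κ τ k i j p := by
  have hs := (sigma_pos hp).ne'
  have hκ := sigma_mul hp
  revert k i j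
  simp only [christoffel, pd_metricMatrix hp, metricMatrix_inv_apply hp, Fin.sum_univ_three,
    metricInvEntry, metricPartial, christoffelPoly, forall_fin_three, triple_zero,
    triple_one, triple_two]
  generalize sigma κ p = s at *
  generalize p 0 = x at *
  generalize p 1 = y at *
  clear hp
  refine ⟨⟨⟨?_, ?_, ?_⟩, ⟨?_, ?_, ?_⟩, ⟨?_, ?_, ?_⟩⟩, ⟨⟨?_, ?_, ?_⟩, ⟨?_, ?_, ?_⟩, ⟨?_, ?_, ?_⟩⟩,
    ⟨⟨?_, ?_, ?_⟩, ⟨?_, ?_, ?_⟩, ⟨?_, ?_, ?_⟩⟩⟩ <;> field_simp <;> grind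

lemma pd_christoffel (hp : p ∈ model κ) (l k i j : Fin 3) :
    pd l (christoffel κ τ k i j) p = pd l (christoffelPoly κ τ k i j) p := by
  apply pd_congr
  filter_upwards [(isOpen_model κ).mem_nhds hp] with q hq using christoffel_eq hq k i j

/-- The Ricci tensor of `𝔼(κ, τ)` is `(κ - 2τ²) g + (4τ² - κ) θ²`, where `θ` is dual to `∂z`. -/
lemma ricci_eq (hp : p ∈ model κ) :
    ricci κ τ 0 0 p = (κ - 2 * τ ^ 2) * sigma κ p ^ 2 + 2 * τ ^ 2 * (sigma κ p * τ * p 1) ^ 2 ∧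
    ricci κ τ 0 1 p = -(2 * τ ^ 2 * (sigma κ p * τ * p 1) * (sigma κ p * τ * p 0)) ∧
    ricci κ τ 1 0 p = -(2 * τ ^ 2 * (sigma κ p * τ * p 1) * (sigma κ p * τ * p 0)) ∧
    ricci κ τ 1 1 p = (κ - 2 * τ ^ 2) * sigma κ p ^ 2 + 2 * τ ^ 2 * (sigma κ p * τ * p 0) ^ 2 := by
  have hκ := sigma_mul hp
  simp only [ricci, pd_christoffel hp, christoffel_eq hp, Fin.sum_univ_three]
  unfold christoffelPoly
  simp only [triple_zero, triple_one, triple_two]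
  simp (disch := first | assumption | fun_prop (disch := assumption)) only
    [pd_mul, pd_add, pd_neg, pd_pow, pd_const, pd_coord, pd_sigma, Fin.reduceEq, reduceIte]
  generalize sigma κ p = s at *
  generalize p 0 = x at *
  generalize p 1 = y at *
  clear hp
  refine ⟨?_, ?_, ?_, ?_⟩
  -- Only the diagonal entries need the relation between σ and x² + y²; the others are polynomial
  -- identities.
  · linear_combination (τ ^ 2 * s / 2 - κ * s / 4) * hκ
  · ring
  · ring
  · linear_combination (τ ^ 2 * s / 2 - κ * s / 4) * hκ

end Ambient

/-! ## Geometry of the cylinder -/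

section Cylinder

lemma pd_apply {n m : ℕ} {f : (Fin n → ℝ) → (Fin m → ℝ)} {p : Fin n → ℝ}
    (hf : DifferentiableAt ℝ f p) (i : Fin n) (k : Fin m) :
    pd i f p k = pd i (fun q => f q k) p := by
  have := (hasFDerivAt_pi'.1 hf.hasFDerivAt k).fderiv
  simp [pd, this]

lemma pd_comp_coord {n : ℕ} {g : ℝ → ℝ} {p : Fin n → ℝ} (i j : Fin n)
    (hg : DifferentiableAt ℝ g (p j)) :
    pd i (fun q => g (q j)) p = if j = i then deriv g (p j) else 0 := by
  have h : HasFDerivAt (fun q : Fin n → ℝ => q j)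
      (ContinuousLinearMap.proj (R := ℝ) (φ := fun _ : Fin n => ℝ) j) p :=
    (ContinuousLinearMap.proj (R := ℝ) (φ := fun _ : Fin n => ℝ) j).hasFDerivAt
  have h2 := hg.hasDerivAt.comp_hasFDerivAt p h
  simp only [Function.comp_def] at h2
  simp [pd, h2.fderiv, Pi.single_apply]

variable {κ τ r : ℝ}

lemma bigR_pos (hr : 0 < r) (hκ : 0 < 4 + κ * r ^ 2) : 0 < bigR κ r := by
  unfold bigR; positivity

lemma cylinder_zero (q : Fin 2 → ℝ) : cylinder κ r q 0 = r * Real.cos (q 0 / bigR κ r) := rfl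

lemma cylinder_one (q : Fin 2 → ℝ) : cylinder κ r q 1 = r * Real.sin (q 0 / bigR κ r) := rfl

lemma cylinder_two (q : Fin 2 → ℝ) : cylinder κ r q 2 = q 1 := rfl

lemma cylinder_sq (q : Fin 2 → ℝ) : cylinder κ r q 0 ^ 2 + cylinder κ r q 1 ^ 2 = r ^ 2 := by
  rw [cylinder_zero, cylinder_one]
  linear_combination r ^ 2 * Real.sin_sq_add_cos_sq (q 0 / bigR κ r)

lemma cylinder_mem (hκ : 0 < 4 + κ * r ^ 2) (q : Fin 2 → ℝ) : cylinder κ r q ∈ model κ := by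
  change 0 < 4 + κ * (cylinder κ r q 0 ^ 2 + cylinder κ r q 1 ^ 2)
  rwa [cylinder_sq]

lemma sigma_cylinder (q : Fin 2 → ℝ) : sigma κ (cylinder κ r q) = 4 / (4 + κ * r ^ 2) := by
  simp only [sigma, cylinder_sq]

lemma contDiff_cylinder : ContDiff ℝ ∞ (cylinder κ r) := by
  unfold cylinder
  rw [contDiff_pi]
  simp only [forall_fin_three]
  refine ⟨?_, ?_, ?_⟩
  · change ContDiff ℝ ∞ fun q : Fin 2 → ℝ => r * Real.cos (q 0 / bigR κ r)
    fun_prop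
  · change ContDiff ℝ ∞ fun q : Fin 2 → ℝ => r * Real.sin (q 0 / bigR κ r)
    fun_prop
  · change ContDiff ℝ ∞ fun q : Fin 2 → ℝ => q 1
    fun_prop

lemma deriv_cos_div (R s : ℝ) :
    deriv (fun x => Real.cos (x / R)) s = -Real.sin (s / R) / R := by
  have : HasDerivAt (fun x => Real.cos (x / R)) (-Real.sin (s / R) * (1 / R)) s :=
    ((hasDerivAt_id s).div_const R).cos
  rw [this.deriv]; ring

lemma deriv_sin_div (R s : ℝ) :
    deriv (fun x => Real.sin (x / R)) s = Real.cos (s / R) / R := by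
  have : HasDerivAt (fun x => Real.sin (x / R)) (Real.cos (s / R) * (1 / R)) s :=
    ((hasDerivAt_id s).div_const R).sin
  rw [this.deriv]; ring

lemma pd_cos_div (R : ℝ) (i : Fin 2) (q : Fin 2 → ℝ) :
    pd i (fun q : Fin 2 → ℝ => Real.cos (q 0 / R)) q
      = if 0 = i then -Real.sin (q 0 / R) / R else 0 := by
  rw [pd_comp_coord (g := fun x => Real.cos (x / R)) i 0 (by fun_prop), deriv_cos_div]

lemma pd_sin_div (R : ℝ) (i : Fin 2) (q : Fin 2 → ℝ) :
    pd i (fun q : Fin 2 → ℝ => Real.sin (q 0 / R)) q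
      = if 0 = i then Real.cos (q 0 / R) / R else 0 := by
  rw [pd_comp_coord (g := fun x => Real.sin (x / R)) i 0 (by fun_prop), deriv_sin_div]

lemma differentiableAt_cylinder (q : Fin 2 → ℝ) : DifferentiableAt ℝ (cylinder κ r) q :=
  (contDiff_cylinder.differentiable (by simp)) q

lemma pd_cylinder_zero : pd 0 (cylinder κ r) = fun q => triple
    (-(r / bigR κ r * Real.sin (q 0 / bigR κ r))) (r / bigR κ r * Real.cos (q 0 / bigR κ r)) 0 := by
  funext q k
  rw [pd_apply (differentiableAt_cylinder q)]
  revert k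
  simp only [forall_fin_three, cylinder_zero, cylinder_one, cylinder_two, triple_zero, triple_one,
    triple_two]
  simp (disch := fun_prop) only [pd_mul, pd_const, pd_cos_div, pd_sin_div, pd_coord, reduceIte,
    Fin.reduceEq, and_true]
  constructor <;> ring

lemma pd_cylinder_one : pd 1 (cylinder κ r) = fun _ => triple 0 0 1 := by
  funext q k
  rw [pd_apply (differentiableAt_cylinder q)]
  revert k
  simp only [forall_fin_three, cylinder_zero, cylinder_one, cylinder_two, triple_zero, triple_one,
    triple_two]
  simp (disch := fun_prop) only [pd_mul, pd_const, pd_cos_div, pd_sin_div, pd_coord, reduceIte,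
    Fin.reduceEq, and_true]
  constructor <;> ring

lemma pd_pd_cylinder (i j : Fin 2) (q : Fin 2 → ℝ) (k : Fin 3) :
    pd i (pd j (cylinder κ r)) q k = if i = 0 ∧ j = 0 then
      triple (-(r / bigR κ r ^ 2 * Real.cos (q 0 / bigR κ r)))
        (-(r / bigR κ r ^ 2 * Real.sin (q 0 / bigR κ r))) 0 k else 0 := by
  have hd : DifferentiableAt ℝ (pd j (cylinder κ r)) q := by
    have h := contDiff_cylinder (κ := κ) (r := r)
    have : ContDiff ℝ ∞ (pd j (cylinder κ r)) :=
      (h.fderiv_right (m := ∞) (by simp)).clm_apply contDiff_const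
    exact this.differentiable (by simp) q
  rw [pd_apply hd]
  revert k i j
  simp only [forall_fin_three, Fin.forall_fin_two, pd_cylinder_zero, pd_cylinder_one, triple_zero,
    triple_one, triple_two]
  simp (disch := fun_prop) only [pd_mul, pd_neg, pd_const, pd_cos_div, pd_sin_div, reduceIte,
    Fin.reduceEq, and_true, and_self, and_false, implies_true]
  grind

/-! ### The normal, the fundamental forms and the Jacobi operator of the cylinder. -/

lemma cylinderNormal_zero (q : Fin 2 → ℝ) : cylinderNormal κ τ r q 0
    = Real.cos (q 0 / bigR κ r) * (4 / (4 + κ * r ^ 2))⁻¹ := by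
  simp [cylinderNormal, sigma_cylinder]

lemma cylinderNormal_one (q : Fin 2 → ℝ) : cylinderNormal κ τ r q 1
    = Real.sin (q 0 / bigR κ r) * (4 / (4 + κ * r ^ 2))⁻¹ := by
  simp [cylinderNormal, sigma_cylinder]

lemma cylinderNormal_two (q : Fin 2 → ℝ) : cylinderNormal κ τ r q 2 = 0 := by
  simp [cylinderNormal, cylinder_zero, cylinder_one]; ring

lemma firstForm_cylinder (hr : 0 < r) (hκ : 0 < 4 + κ * r ^ 2) (q : Fin 2 → ℝ) :
    firstForm κ τ (cylinder κ r) q = !![1 + τ ^ 2 * r ^ 2, -(τ * r); -(τ * r), 1] := by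
  have h1 : r / bigR κ r = (4 / (4 + κ * r ^ 2))⁻¹ := by unfold bigR; field_simp
  have hs : (4 / (4 + κ * r ^ 2)) ≠ 0 := by positivity
  have hc := Real.sin_sq_add_cos_sq (q 0 / bigR κ r)
  rw [← Matrix.ext_iff]
  simp only [Fin.forall_fin_two, firstForm, Matrix.of_apply, metric, pd_cylinder_zero,
    pd_cylinder_one, triple_zero, triple_one, triple_two, sigma_cylinder, cylinder_zero,
    cylinder_one, h1]
  generalize 4 / (4 + κ * r ^ 2) = s at *
  generalize Real.cos (q 0 / bigR κ r) = c at *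
  generalize Real.sin (q 0 / bigR κ r) = w at *
  have hs' : s * s⁻¹ = 1 := mul_inv_cancel₀ hs
  generalize s⁻¹ = a at *
  simp only [Matrix.cons_val', Matrix.cons_val_zero, Matrix.cons_val_one, Matrix.cons_val_fin_one]
  refine ⟨⟨?_, ?_⟩, ?_, ?_⟩ <;> grind

lemma areaDensity_cylinder (hr : 0 < r) (hκ : 0 < 4 + κ * r ^ 2) (q : Fin 2 → ℝ) :
    areaDensity κ τ (cylinder κ r) q = 1 := by
  rw [areaDensity, firstForm_cylinder hr hκ, Matrix.det_fin_two_of, Real.sqrt_eq_one]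
  ring

lemma firstForm_cylinder_inv (hr : 0 < r) (hκ : 0 < 4 + κ * r ^ 2) (q : Fin 2 → ℝ) :
    (firstForm κ τ (cylinder κ r) q)⁻¹ = !![1, τ * r; τ * r, 1 + τ ^ 2 * r ^ 2] := by
  rw [firstForm_cylinder hr hκ]
  apply Matrix.inv_eq_right_inv
  rw [Matrix.mul_fin_two, Matrix.one_fin_two]
  congr! <;> ring

/-- The zero entry reflects that the vertical fibres are geodesics. The term -2τ²r arises because ∂s
is not orthogonal to the fibres; it cancels in the trace, leaving minus the geodesic curvature of α,
since N points outwards. -/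
lemma secondForm_cylinder (hr : 0 < r) (hκ : 0 < 4 + κ * r ^ 2) (q : Fin 2 → ℝ) :
    secondForm κ τ (cylinder κ r) (cylinderNormal κ τ r) q =
      !![-((4 - κ * r ^ 2) / (4 * r)) - 2 * τ ^ 2 * r, τ; τ, 0] := by
  have h1 : r / bigR κ r = (4 / (4 + κ * r ^ 2))⁻¹ := by unfold bigR; field_simp
  have h2 : r / bigR κ r ^ 2 = (4 / (4 + κ * r ^ 2))⁻¹ ^ 2 / r := by unfold bigR; field_simp
  -- Solving σ = 4 / (4 + κr²) for κ lets κ be eliminated, so that each entry becomes an identity in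
  -- r, σ and their inverses.
  have h3 : κ = 4 * ((4 / (4 + κ * r ^ 2))⁻¹ - 1) / r ^ 2 := by field_simp; ring
  have hs : (4 / (4 + κ * r ^ 2)) ≠ 0 := by positivity
  have hc := Real.sin_sq_add_cos_sq (q 0 / bigR κ r)
  rw [← Matrix.ext_iff]
  simp only [Fin.forall_fin_two, secondForm, Matrix.of_apply, metric, covDeriv,
    christoffel_eq (cylinder_mem hκ q), pd_pd_cylinder, Fin.sum_univ_three, cylinderNormal_zero,
    cylinderNormal_one, cylinderNormal_two, christoffelPoly, pd_cylinder_zero, and_true, and_false,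
    pd_cylinder_one, triple_zero, triple_one, triple_two, sigma_cylinder, cylinder_zero,
    cylinder_one, h1, h2, reduceIte, Fin.reduceEq, Matrix.cons_val',
    Matrix.cons_val_zero, Matrix.cons_val_one, Matrix.cons_val_fin_one]
  generalize 4 / (4 + κ * r ^ 2) = s at *
  generalize Real.cos (q 0 / bigR κ r) = c at *
  generalize Real.sin (q 0 / bigR κ r) = w at *
  have hs' : s * s⁻¹ = 1 := mul_inv_cancel₀ hs
  generalize s⁻¹ = a at *
  have hr' : r * r⁻¹ = 1 := mul_inv_cancel₀ hr.ne'
  subst h3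
  refine ⟨⟨?_, ?_⟩, ?_, ?_⟩
  · grind
  · grind
  · grind
  · grind

lemma meanCurvature_cylinder (hr : 0 < r) (hκ : 0 < 4 + κ * r ^ 2) (q : Fin 2 → ℝ) :
    meanCurvature κ τ (cylinder κ r) (cylinderNormal κ τ r) q = -((4 - κ * r ^ 2) / (8 * r)) := by
  rw [meanCurvature, firstForm_cylinder_inv hr hκ, secondForm_cylinder hr hκ]
  simp only [Fin.sum_univ_two, Matrix.of_apply, Matrix.cons_val', Matrix.cons_val_zero,
    Matrix.cons_val_one, Matrix.cons_val_fin_one]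
  field_simp
  ring

lemma secondFormNormSq_cylinder (hr : 0 < r) (hκ : 0 < 4 + κ * r ^ 2) (q : Fin 2 → ℝ) :
    secondFormNormSq κ τ (cylinder κ r) (cylinderNormal κ τ r) q
      = ((4 - κ * r ^ 2) / (4 * r)) ^ 2 + 2 * τ ^ 2 := by
  rw [secondFormNormSq, firstForm_cylinder_inv hr hκ, secondForm_cylinder hr hκ]
  simp only [Fin.sum_univ_two, Matrix.of_apply, Matrix.cons_val', Matrix.cons_val_zero,
    Matrix.cons_val_one, Matrix.cons_val_fin_one]
  field_simp
  ring

lemma ricciCurvature_cylinder (hκ : 0 < 4 + κ * r ^ 2) (q : Fin 2 → ℝ) :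
    ricciCurvature κ τ (cylinder κ r q) (cylinderNormal κ τ r q) = κ - 2 * τ ^ 2 := by
  have hs : (4 / (4 + κ * r ^ 2)) ≠ 0 := by positivity
  have hc := Real.sin_sq_add_cos_sq (q 0 / bigR κ r)
  obtain ⟨h00, h01, h10, h11⟩ := ricci_eq (τ := τ) (cylinder_mem hκ q)
  simp only [ricciCurvature, Fin.sum_univ_three, cylinderNormal_zero, cylinderNormal_one,
    cylinderNormal_two, h00, h01, h10, h11, sigma_cylinder, cylinder_zero, cylinder_one, mul_zero]
  generalize 4 / (4 + κ * r ^ 2) = s at *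
  generalize Real.cos (q 0 / bigR κ r) = c at *
  generalize Real.sin (q 0 / bigR κ r) = w at *
  have hs' : s * s⁻¹ = 1 := mul_inv_cancel₀ hs
  generalize s⁻¹ = a at *
  grind

lemma laplacian_cylinder (hr : 0 < r) (hκ : 0 < 4 + κ * r ^ 2) {v : ℝ → ℝ} (hv : ContDiff ℝ ∞ v)
    (q : Fin 2 → ℝ) : laplacian κ τ (cylinder κ r) (fun q => v (q 1)) q
      = (1 + τ ^ 2 * r ^ 2) * deriv (deriv v) (q 1) := by
  have hv1 : Differentiable ℝ v := hv.differentiable (by simp)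
  have hv2 : Differentiable ℝ (deriv v) :=
    (hv.iterate_deriv 1).differentiable (by simp)
  have h (j : Fin 2) (p : Fin 2 → ℝ) : pd j (fun q : Fin 2 → ℝ => v (q 1)) p
      = if 1 = j then deriv v (p 1) else 0 := pd_comp_coord j 1 (hv1 _)
  have h' (j : Fin 2) (p : Fin 2 → ℝ) : pd j (fun q : Fin 2 → ℝ => deriv v (q 1)) p
      = if 1 = j then deriv (deriv v) (p 1) else 0 := pd_comp_coord j 1 (hv2 _)
  have hd : DifferentiableAt ℝ (fun q : Fin 2 → ℝ => deriv v (q 1)) q :=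
    (hv2 _).comp q (by fun_prop)
  simp only [laplacian, areaDensity_cylinder hr hκ, firstForm_cylinder_inv hr hκ, h,
    Fin.sum_univ_two, Matrix.of_apply, Matrix.cons_val', Matrix.cons_val_zero,
    Matrix.cons_val_one, Matrix.cons_val_fin_one, reduceIte, Fin.reduceEq]
  simp (disch := first | assumption | fun_prop (disch := assumption)) only [pd_mul, pd_const, h',
    reduceIte, Fin.reduceEq]
  ring

/-- Let k = (4 - κr²)/(4r) be the geodesic curvature of α. In |A|² + Ric(N) = (k² + 2τ²) + (κ - 2τ²)
the torsion cancels, and k² + κ = 1/R² because (4 - κr²)² + 16κr² = (4 + κr²)². -/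
lemma jacobi_cylinder (hr : 0 < r) (hκ : 0 < 4 + κ * r ^ 2) {v : ℝ → ℝ} (hv : ContDiff ℝ ∞ v)
    (q : Fin 2 → ℝ) :
    jacobi κ τ (cylinder κ r) (cylinderNormal κ τ r) (fun q => v (q 1)) q
      = (1 + τ ^ 2 * r ^ 2) * deriv (deriv v) (q 1) + v (q 1) / bigR κ r ^ 2 := by
  rw [jacobi, laplacian_cylinder hr hκ hv, secondFormNormSq_cylinder hr hκ,
    ricciCurvature_cylinder hκ, bigR]
  field_simp
  ring

/-- The one-dimensional form `∫₀ᴸ (1 + τ²r²) v'² - v² / R²`. -/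
def profileForm (κ τ r L : ℝ) (v : ℝ → ℝ) : ℝ :=
  (1 + τ ^ 2 * r ^ 2) * (∫ t in (0 : ℝ)..L, deriv v t ^ 2)
    - (∫ t in (0 : ℝ)..L, v t ^ 2) / bigR κ r ^ 2

/-! ### Reduction of Q to the one-dimensional form. -/

lemma surfaceIntegral_cylinder (hr : 0 < r) (hκ : 0 < 4 + κ * r ^ 2) (L : ℝ) (v : ℝ → ℝ) :
    surfaceIntegral κ τ (2 * Real.pi * bigR κ r) L (cylinder κ r) (fun q => v (q 1))
      = 2 * Real.pi * bigR κ r * ∫ t in (0 : ℝ)..L, v t := by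
  simp [surfaceIntegral, areaDensity_cylinder hr hκ]

lemma quadForm_eq (hr : 0 < r) (hκ : 0 < 4 + κ * r ^ 2) {L : ℝ} {v : ℝ → ℝ}
    (hv : ContDiff ℝ ∞ v) (h0 : v 0 = 0) (hL : v L = 0) :
    quadForm κ τ r L (fun q => v (q 1)) = 2 * Real.pi * bigR κ r * profileForm κ τ r L v := by
  have hv1 : Differentiable ℝ v := hv.differentiable (by simp)
  have hv' : ContDiff ℝ ∞ (deriv v) := hv.iterate_deriv 1
  have hv2 : Differentiable ℝ (deriv v) := hv'.differentiable (by simp)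
  have hv3 : Continuous (deriv (deriv v)) := (hv'.iterate_deriv 1).continuous
  have hparts : ∫ t in (0 : ℝ)..L, v t * deriv (deriv v) t
      = -∫ t in (0 : ℝ)..L, deriv v t ^ 2 := by
    rw [intervalIntegral.integral_mul_deriv_eq_deriv_mul (u' := deriv v)
      (fun x _ => (hv1 x).hasDerivAt) (fun x _ => (hv2 x).hasDerivAt)
      (hv2.continuous.intervalIntegrable _ _) (hv3.intervalIntegrable _ _), h0, hL]
    simp [pow_two]
  simp only [quadForm, jacobi_cylinder hr hκ hv]
  rw [surfaceIntegral_cylinder hr hκ L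
    (fun t => v t * ((1 + τ ^ 2 * r ^ 2) * deriv (deriv v) t + v t / bigR κ r ^ 2))]
  have hsplit : ∫ t in (0 : ℝ)..L,
      v t * ((1 + τ ^ 2 * r ^ 2) * deriv (deriv v) t + v t / bigR κ r ^ 2)
      = (1 + τ ^ 2 * r ^ 2) * (∫ t in (0 : ℝ)..L, v t * deriv (deriv v) t)
        + (∫ t in (0 : ℝ)..L, v t ^ 2) / bigR κ r ^ 2 := by
    rw [← intervalIntegral.integral_const_mul, ← intervalIntegral.integral_div,
      ← intervalIntegral.integral_add]
    · congr 1; funext t; ring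
    · exact Continuous.intervalIntegrable (by have := hv.continuous; fun_prop) _ _
    · exact Continuous.intervalIntegrable (by have := hv.continuous; fun_prop) _ _
  rw [hsplit, hparts, profileForm]
  ring

lemma IsAxialTest.exists_profile {L : ℝ} {u : (Fin 2 → ℝ) → ℝ} (hu : IsAxialTest L u) :
    ∃ v : ℝ → ℝ, ContDiff ℝ ∞ v ∧ v 0 = 0 ∧ v L = 0 ∧ u = fun q => v (q 1) := by
  refine ⟨fun t => u ![0, t], ?_, hu.bottom 0, hu.top 0, ?_⟩
  · refine hu.smooth.comp ?_
    rw [contDiff_pi]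
    simp only [Fin.forall_fin_two, Matrix.cons_val_zero, Matrix.cons_val_one,
      Matrix.cons_val_fin_one]
    exact ⟨contDiff_const, contDiff_id⟩
  · funext q
    have h := hu.axial 0 (q 0) (q 1)
    rw [zero_add] at h
    change u q = u ![0, q 1]
    rw [← h]
    congr 1
    ext i
    fin_cases i <;> rfl

lemma isAxialTest_of_profile {L : ℝ} {v : ℝ → ℝ} (hv : ContDiff ℝ ∞ v) (h0 : v 0 = 0)
    (hL : v L = 0) : IsAxialTest L (fun q => v (q 1)) where
  smooth := hv.comp (by fun_prop)
  axial _ _ _ := rfl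
  bottom _ := h0
  top _ := hL

lemma formStronglyStable_iff (hr : 0 < r) (hκ : 0 < 4 + κ * r ^ 2) (L : ℝ) :
    FormStronglyStable κ τ r L ↔ ∀ v : ℝ → ℝ, ContDiff ℝ ∞ v → v 0 = 0 → v L = 0 →
      0 ≤ profileForm κ τ r L v := by
  have hR := bigR_pos hr hκ
  have hpos : 0 < 2 * Real.pi * bigR κ r := by positivity
  constructor
  · intro h v hv h0 hL
    have := h _ (isAxialTest_of_profile hv h0 hL)
    rw [quadForm_eq hr hκ hv h0 hL] at this
    exact nonneg_of_mul_nonneg_right this hpos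
  · intro h u hu
    obtain ⟨v, hv, h0, hL, rfl⟩ := hu.exists_profile
    rw [quadForm_eq hr hκ hv h0 hL]
    exact mul_nonneg hpos.le (h v hv h0 hL)

lemma formStable_iff (hr : 0 < r) (hκ : 0 < 4 + κ * r ^ 2) (L : ℝ) :
    FormStable κ τ r L ↔ ∀ v : ℝ → ℝ, ContDiff ℝ ∞ v → v 0 = 0 → v L = 0 →
      ∫ t in (0 : ℝ)..L, v t = 0 → 0 ≤ profileForm κ τ r L v := by
  have hR := bigR_pos hr hκ
  have hpos : 0 < 2 * Real.pi * bigR κ r := by positivity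
  constructor
  · intro h v hv h0 hL hint
    have := h _ (isAxialTest_of_profile hv h0 hL)
      (by rw [surfaceIntegral_cylinder hr hκ, hint, mul_zero])
    rw [quadForm_eq hr hκ hv h0 hL] at this
    exact nonneg_of_mul_nonneg_right this hpos
  · intro h u hu hint
    obtain ⟨v, hv, h0, hL, rfl⟩ := hu.exists_profile
    rw [surfaceIntegral_cylinder hr hκ] at hint
    rw [quadForm_eq hr hκ hv h0 hL]
    exact mul_nonneg hpos.le
      (h v hv h0 hL ((mul_eq_zero.1 hint).resolve_left hpos.ne'))

end Cylinder

/-! ## One-dimensional inequalities -/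

section Wirtinger

/-- The inequality behind Wirtinger's: integrate `(f' + b tan(b(t - m)) f)² ≥ 0`. -/
lemma integral_sq_deriv_sub_ge {f : ℝ → ℝ} (hf : ContDiff ℝ ∞ f) {b m p q : ℝ} (hpq : p ≤ q)
    (hb : ∀ t ∈ Icc p q, Real.cos (b * (t - m)) ≠ 0) :
    b * Real.tan (b * (p - m)) * f p ^ 2 - b * Real.tan (b * (q - m)) * f q ^ 2
      ≤ (∫ t in p..q, deriv f t ^ 2) - b ^ 2 * ∫ t in p..q, f t ^ 2 := by
  have hf1 : Differentiable ℝ f := hf.differentiable (by simp)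
  have hf2 : Continuous (deriv f) := (hf.iterate_deriv 1).continuous
  have htan : ∀ t ∈ Icc p q, HasDerivAt (fun t => b * Real.tan (b * (t - m)))
      (b ^ 2 * (1 + Real.tan (b * (t - m)) ^ 2)) t := by
    intro t ht
    have h1 : HasDerivAt (fun t : ℝ => b * (t - m)) (b * 1) t :=
      ((hasDerivAt_id t).sub_const m).const_mul b
    have h2 := ((Real.hasDerivAt_tan (hb t ht)).comp t h1).const_mul b
    refine h2.congr_deriv ?_
    rw [Real.tan_eq_sin_div_cos]
    have := hb t ht
    field_simp
    linear_combination -b ^ 2 * Real.sin_sq_add_cos_sq (b * (t - m))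
  have hc : ContinuousOn (fun t => b * Real.tan (b * (t - m))) (Icc p q) :=
    fun t ht => (htan t ht).continuousAt.continuousWithinAt
  have hct : ContinuousOn (fun t => Real.tan (b * (t - m))) (Icc p q) := by
    intro t ht
    have h1 : HasDerivAt (fun t : ℝ => b * (t - m)) (b * 1) t :=
      ((hasDerivAt_id t).sub_const m).const_mul b
    exact ((Real.hasDerivAt_tan (hb t ht)).comp t h1).continuousAt.continuousWithinAt
  have hfc := hf.continuous
  have hderiv : ∀ t ∈ uIcc p q, HasDerivAt (fun t => b * Real.tan (b * (t - m)) * f t ^ 2)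
      (b ^ 2 * (1 + Real.tan (b * (t - m)) ^ 2) * f t ^ 2
        + b * Real.tan (b * (t - m)) * (2 * f t * deriv f t)) t := by
    intro t ht
    rw [uIcc_of_le hpq] at ht
    refine ((htan t ht).mul ((hf1 t).hasDerivAt.pow 2)).congr_deriv ?_
    simp
  have hcont : ContinuousOn (fun t => b ^ 2 * (1 + Real.tan (b * (t - m)) ^ 2) * f t ^ 2
        + b * Real.tan (b * (t - m)) * (2 * f t * deriv f t)) (uIcc p q) := by
    rw [uIcc_of_le hpq]; fun_prop
  have hftc := intervalIntegral.integral_eq_sub_of_hasDerivAt hderiv hcont.intervalIntegrable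
  have hnn : 0 ≤ ∫ t in p..q, (deriv f t + b * Real.tan (b * (t - m)) * f t) ^ 2 :=
    intervalIntegral.integral_nonneg hpq fun t _ => sq_nonneg _
  -- With φ = b tan(b(t - m)) one has φ' = b² + φ², hence (f' + φf)² = f'² - b²f² + (φf²)'.
  have heq : ∫ t in p..q, (deriv f t + b * Real.tan (b * (t - m)) * f t) ^ 2
      = ((∫ t in p..q, deriv f t ^ 2) - b ^ 2 * ∫ t in p..q, f t ^ 2)
        + ∫ t in p..q, (b ^ 2 * (1 + Real.tan (b * (t - m)) ^ 2) * f t ^ 2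
          + b * Real.tan (b * (t - m)) * (2 * f t * deriv f t)) := by
    rw [← intervalIntegral.integral_const_mul, ← intervalIntegral.integral_sub,
      ← intervalIntegral.integral_add]
    · congr 1; funext t; ring
    · exact Continuous.intervalIntegrable (by fun_prop) _ _
    · exact hcont.intervalIntegrable
    · exact Continuous.intervalIntegrable (by fun_prop) _ _
    · exact Continuous.intervalIntegrable (by fun_prop) _ _
  rw [heq, hftc] at hnn
  linarith

lemma cos_ne_zero_of_lt {b t m l : ℝ} (hb : 0 < b) (ht : |t - m| ≤ l / 2) (hl : b * l < Real.pi) :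
    Real.cos (b * (t - m)) ≠ 0 := by
  have h := abs_le.1 ht
  apply (Real.cos_pos_of_mem_Ioo ⟨?_, ?_⟩).ne' <;> nlinarith

/-- Poincaré's inequality on an interval with Dirichlet boundary conditions. -/
lemma integral_sq_le_of_dirichlet {f : ℝ → ℝ} (hf : ContDiff ℝ ∞ f) {L b : ℝ} (hL : 0 < L)
    (hb : 0 < b) (hbL : b * L ≤ Real.pi) (h0 : f 0 = 0) (h1 : f L = 0) :
    b ^ 2 * (∫ t in (0 : ℝ)..L, f t ^ 2) ≤ ∫ t in (0 : ℝ)..L, deriv f t ^ 2 := by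
  -- For c < b the cosine centred at L/2 has no zero on the closed interval, even when bL = π; the
  -- limit c → b recovers the sharp constant.
  have key : ∀ c ∈ Ioo 0 b, c ^ 2 * (∫ t in (0 : ℝ)..L, f t ^ 2)
      ≤ ∫ t in (0 : ℝ)..L, deriv f t ^ 2 := by
    intro c hc
    have := integral_sq_deriv_sub_ge hf (b := c) (m := L / 2) hL.le (fun t ht =>
      cos_ne_zero_of_lt (l := L) hc.1
        (abs_le.2 ⟨by linarith [ht.1], by linarith [ht.2]⟩) (by nlinarith [hc.2]))
    rw [h0, h1] at this
    linarith
  refine le_of_tendsto (f := fun c : ℝ => c ^ 2 * (∫ t in (0 : ℝ)..L, f t ^ 2))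
    (x := nhdsWithin b (Iio b)) ?_ ?_
  · exact (Continuous.tendsto (by fun_prop) b).mono_left nhdsWithin_le_nhds
  · filter_upwards [Ioo_mem_nhdsLT hb] with c hc using key c hc

/-- Since f(0) = f(L), f may be viewed on a circle of length L. It takes a common value a at two
antipodal points x and x + L/2, so f - a vanishes at the ends of two arcs of length L/2, and the
Dirichlet argument on each arc gives the constant 2π/L. Mean zero makes the shift by a harmless, as
∫ (f - a)² = ∫ f² + La². -/
lemma integral_sq_le_of_mean_zero {f : ℝ → ℝ} (hf : ContDiff ℝ ∞ f) {L b : ℝ} (hL : 0 < L)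
    (hb : 0 < b) (hbL : b * L ≤ 2 * Real.pi) (h0 : f 0 = 0) (h1 : f L = 0)
    (hmean : ∫ t in (0 : ℝ)..L, f t = 0) :
    b ^ 2 * (∫ t in (0 : ℝ)..L, f t ^ 2) ≤ ∫ t in (0 : ℝ)..L, deriv f t ^ 2 := by
  have hfc := hf.continuous
  obtain ⟨x, hx, hfx⟩ : ∃ x ∈ Icc 0 (L / 2), f x = f (x + L / 2) := by
    have hc : ContinuousOn (fun x => f x - f (x + L / 2)) (uIcc 0 (L / 2)) := by fun_prop
    -- The difference f(x) - f(x + L/2) equals -f(L/2) at 0 and f(L/2) at L/2, hence changes sign.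
    have h := intermediate_value_uIcc hc (show (0 : ℝ) ∈ _ by
      simp only [zero_add, add_halves, h0, h1, zero_sub, sub_zero]
      rcases le_total 0 (f (L / 2)) with h | h
      · exact mem_uIcc_of_le (by linarith) h
      · exact mem_uIcc_of_ge h (by linarith))
    obtain ⟨x, hx, hx'⟩ := h
    exact ⟨x, by rwa [uIcc_of_le (by linarith)] at hx, by simpa [sub_eq_zero] using hx'⟩
  set a := f x with ha
  set g : ℝ → ℝ := fun t => f t - a with hg
  have hgs : ContDiff ℝ ∞ g := hf.sub contDiff_const
  have hgc := hgs.continuous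
  have hg' : deriv g = deriv f := by funext t; simp [hg]
  have hf2 : Continuous (deriv f) := (hf.iterate_deriv 1).continuous
  have key : ∀ c ∈ Ioo 0 b, c ^ 2 * (∫ t in (0 : ℝ)..L, g t ^ 2)
      ≤ ∫ t in (0 : ℝ)..L, deriv f t ^ 2 := by
    intro c hc
    have hlt : c * (L / 2) < Real.pi := by nlinarith [hc.2]
    -- The three intervals are the arc from x to x + L/2 and the two pieces of the other arc, which
    -- is cut at 0 = L. The centres x - L/4 and x + 3L/4 are the same point of the circle.
    have i1 := integral_sq_deriv_sub_ge hgs (b := c) (m := x - L / 4) (p := 0) (q := x) hx.1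
      (fun t ht => cos_ne_zero_of_lt (l := L / 2) hc.1
        (abs_le.2 ⟨by linarith [ht.1, hx.2], by linarith [ht.2]⟩) hlt)
    have i2 := integral_sq_deriv_sub_ge hgs (b := c) (m := x + L / 4) (p := x) (q := x + L / 2)
      (by linarith) (fun t ht => cos_ne_zero_of_lt (l := L / 2) hc.1
        (abs_le.2 ⟨by linarith [ht.1], by linarith [ht.2]⟩) hlt)
    have i3 := integral_sq_deriv_sub_ge hgs (b := c) (m := x + L * (3 / 4))
      (p := x + L / 2) (q := L)
      (by linarith [hx.2]) (fun t ht => cos_ne_zero_of_lt (l := L / 2) hc.1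
        (abs_le.2 ⟨by linarith [ht.1], by linarith [ht.2, hx.1]⟩) hlt)
    have gx : g x = 0 := sub_self _
    have gx' : g (x + L / 2) = 0 := by simp [hg, ← hfx]
    have g0 : g 0 = -a := by simp [hg, h0]
    have gL : g L = -a := by simp [hg, h1]
    rw [gx, g0] at i1
    rw [gx, gx'] at i2
    rw [gL, gx'] at i3
    rw [hg'] at i1 i2 i3
    -- Equal tangents at both sides of the cut, where g takes the same value -a: the two remaining
    -- boundary terms cancel in the sum.
    have hm : c * (L - (x + L * (3 / 4))) = c * (0 - (x - L / 4)) := by ring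
    rw [hm] at i3
    have s1 : ∀ F : ℝ → ℝ, Continuous F → ∫ t in (0 : ℝ)..L, F t
        = (∫ t in (0 : ℝ)..x, F t) + (∫ t in x..(x + L / 2), F t) + ∫ t in (x + L / 2)..L, F t := by
      intro F hF
      rw [intervalIntegral.integral_add_adjacent_intervals (hF.intervalIntegrable _ _)
        (hF.intervalIntegrable _ _), intervalIntegral.integral_add_adjacent_intervals
        (hF.intervalIntegrable _ _) (hF.intervalIntegrable _ _)]
    rw [s1 (fun t => g t ^ 2) (by fun_prop), s1 (fun t => deriv f t ^ 2) (by fun_prop)]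
    linarith
  have hlim : b ^ 2 * (∫ t in (0 : ℝ)..L, g t ^ 2) ≤ ∫ t in (0 : ℝ)..L, deriv f t ^ 2 := by
    refine le_of_tendsto (f := fun c : ℝ => c ^ 2 * (∫ t in (0 : ℝ)..L, g t ^ 2))
      (x := nhdsWithin b (Iio b)) ?_ ?_
    · exact (Continuous.tendsto (by fun_prop) b).mono_left nhdsWithin_le_nhds
    · filter_upwards [Ioo_mem_nhdsLT hb] with c hc using key c hc
  have hgint : ∫ t in (0 : ℝ)..L, g t ^ 2 = (∫ t in (0 : ℝ)..L, f t ^ 2) + L * a ^ 2 := by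
    have : ∀ t, g t ^ 2 = f t ^ 2 - 2 * a * f t + a ^ 2 := fun t => by simp only [hg]; ring
    simp only [this]
    rw [intervalIntegral.integral_add, intervalIntegral.integral_sub,
      intervalIntegral.integral_const_mul, hmean]
    · simp
    all_goals exact Continuous.intervalIntegrable (by fun_prop) _ _
  rw [hgint] at hlim
  linarith [mul_nonneg (sq_nonneg b) (mul_nonneg hL.le (sq_nonneg a)),
    mul_add (b ^ 2) (∫ t in (0 : ℝ)..L, f t ^ 2) (L * a ^ 2)]

/-! ### Sine test functions and the sign of the one-dimensional form. -/

lemma contDiff_sin_mul (c : ℝ) : ContDiff ℝ ∞ (fun t : ℝ => Real.sin (c * t)) := by fun_prop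

lemma deriv_sin_mul (c : ℝ) :
    deriv (fun t : ℝ => Real.sin (c * t)) = fun t => c * Real.cos (c * t) := by
  funext t
  have h : HasDerivAt (fun t : ℝ => Real.sin (c * t)) (Real.cos (c * t) * (c * 1)) t :=
    ((hasDerivAt_id t).const_mul c).sin
  rw [h.deriv]; ring

lemma integral_sin_sq_mul {c L : ℝ} (hc : c ≠ 0) (h : Real.sin (c * L) = 0) :
    ∫ t in (0 : ℝ)..L, Real.sin (c * t) ^ 2 = L / 2 := by
  rw [intervalIntegral.integral_comp_mul_left (fun x => Real.sin x ^ 2) hc, integral_sin_sq, h]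
  simp
  field_simp

lemma integral_cos_sq_mul {c L : ℝ} (hc : c ≠ 0) (h : Real.sin (c * L) = 0) :
    ∫ t in (0 : ℝ)..L, Real.cos (c * t) ^ 2 = L / 2 := by
  rw [intervalIntegral.integral_comp_mul_left (fun x => Real.cos x ^ 2) hc, integral_cos_sq, h]
  simp
  field_simp

lemma profileForm_sin {κ τ r L c : ℝ} (hc : c ≠ 0) (h : Real.sin (c * L) = 0) :
    profileForm κ τ r L (fun t => Real.sin (c * t))
      = L / 2 * ((1 + τ ^ 2 * r ^ 2) * c ^ 2 - 1 / bigR κ r ^ 2) := by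
  rw [profileForm, deriv_sin_mul, integral_sin_sq_mul hc h]
  simp only [mul_pow, intervalIntegral.integral_const_mul]
  rw [integral_cos_sq_mul hc h]
  ring

lemma sin_pi_div_mul {L : ℝ} (hL : 0 < L) (k : ℕ) : Real.sin (k * Real.pi / L * L) = 0 := by
  rw [div_mul_cancel₀ _ hL.ne', Real.sin_nat_mul_pi]

lemma integral_sin_two_pi_div {L : ℝ} (hL : 0 < L) :
    ∫ t in (0 : ℝ)..L, Real.sin ((2 : ℕ) * Real.pi / L * t) = 0 := by
  have hc : (2 : ℕ) * Real.pi / L ≠ 0 := by positivity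
  rw [intervalIntegral.integral_comp_mul_left (fun x => Real.sin x) hc, integral_sin,
    div_mul_cancel₀ _ hL.ne']
  simp

variable {κ τ r L : ℝ}

/-- The length `L₀ = 2πR√(1 + τ²r²)`. -/
def profileLength (κ τ r : ℝ) : ℝ := 2 * Real.pi * bigR κ r * Real.sqrt (1 + τ ^ 2 * r ^ 2)

/-- This value of b satisfies K b² = 1/R², so K times the Poincaré inequality is the nonnegativity
of the form. -/
lemma profileForm_nonneg_of_le {v : ℝ → ℝ} {b : ℝ}
    (hb : b = 1 / (bigR κ r * Real.sqrt (1 + τ ^ 2 * r ^ 2)))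
    (h : b ^ 2 * (∫ t in (0 : ℝ)..L, v t ^ 2) ≤ ∫ t in (0 : ℝ)..L, deriv v t ^ 2) :
    0 ≤ profileForm κ τ r L v := by
  have hK : 0 < 1 + τ ^ 2 * r ^ 2 := by positivity
  have hb2 : (1 + τ ^ 2 * r ^ 2) * b ^ 2 = 1 / bigR κ r ^ 2 := by
    rw [hb, div_pow, mul_pow, Real.sq_sqrt hK.le]
    field_simp
  have := mul_le_mul_of_nonneg_left h hK.le
  rw [← mul_assoc, hb2] at this
  rw [profileForm]
  have e : (∫ t in (0 : ℝ)..L, v t ^ 2) / bigR κ r ^ 2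
    = 1 / bigR κ r ^ 2 * ∫ t in (0 : ℝ)..L, v t ^ 2 := by ring
  rw [e]
  linarith

lemma profileForm_nonneg (hr : 0 < r) (hκ : 0 < 4 + κ * r ^ 2) (hL : 0 < L)
    (hle : L ≤ profileLength κ τ r / 2) {v : ℝ → ℝ} (hv : ContDiff ℝ ∞ v) (h0 : v 0 = 0)
    (h1 : v L = 0) : 0 ≤ profileForm κ τ r L v := by
  have hR := bigR_pos hr hκ
  have hS : 0 < Real.sqrt (1 + τ ^ 2 * r ^ 2) := Real.sqrt_pos.2 (by positivity)
  refine profileForm_nonneg_of_le rfl (integral_sq_le_of_dirichlet hv hL (by positivity) ?_ h0 h1)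
  rw [profileLength] at hle
  rw [div_mul_eq_mul_div, one_mul, div_le_iff₀ (by positivity)]
  linarith

lemma profileForm_nonneg_of_mean_zero (hr : 0 < r) (hκ : 0 < 4 + κ * r ^ 2) (hL : 0 < L)
    (hle : L ≤ profileLength κ τ r) {v : ℝ → ℝ} (hv : ContDiff ℝ ∞ v) (h0 : v 0 = 0)
    (h1 : v L = 0) (hmean : ∫ t in (0 : ℝ)..L, v t = 0) : 0 ≤ profileForm κ τ r L v := by
  have hR := bigR_pos hr hκ
  have hS : 0 < Real.sqrt (1 + τ ^ 2 * r ^ 2) := Real.sqrt_pos.2 (by positivity)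
  refine profileForm_nonneg_of_le rfl
    (integral_sq_le_of_mean_zero hv hL (by positivity) ?_ h0 h1 hmean)
  rw [profileLength] at hle
  rw [div_mul_eq_mul_div, one_mul, div_le_iff₀ (by positivity)]
  linarith

/-- Used with k = 1 against strong stability and with k = 2, where the sine has mean zero, against
stability. -/
lemma profileForm_sin_neg (hr : 0 < r) (hκ : 0 < 4 + κ * r ^ 2) (hL : 0 < L) {k : ℕ} (hk : 0 < k)
    (hlt : k * profileLength κ τ r / 2 < L) :
    profileForm κ τ r L (fun t => Real.sin (k * Real.pi / L * t)) < 0 := by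
  have hR := bigR_pos hr hκ
  have hK : 0 < 1 + τ ^ 2 * r ^ 2 := by positivity
  have hS : 0 < Real.sqrt (1 + τ ^ 2 * r ^ 2) := Real.sqrt_pos.2 hK
  have hk' : (0 : ℝ) < k := by exact_mod_cast hk
  rw [profileForm_sin (by positivity) (sin_pi_div_mul hL k)]
  apply mul_neg_of_pos_of_neg (by positivity)
  rw [sub_neg, div_pow, mul_div_assoc', div_lt_div_iff₀ (by positivity) (by positivity), one_mul]
  rw [profileLength] at hlt
  have h2 : k * Real.pi * bigR κ r * Real.sqrt (1 + τ ^ 2 * r ^ 2) < L := by linarith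
  have h3 := pow_lt_pow_left₀ h2 (by positivity) two_ne_zero
  rw [mul_pow, Real.sq_sqrt hK.le] at h3
  linarith

end Wirtinger

/-! ## The critical length -/

/-- With k = √|κ| and w = rk/2, the quantity ρk/2 is artanh w or arctan w. The double-angle formula
gives 2w/(1 ∓ w²) = kR for the sinh or sine of ρk, while the square root is k√(1 + τ²r²). -/
lemma criticalLength_eq {κ τ r : ℝ} (hr : 0 < r) (hκ : 0 < 4 + κ * r ^ 2) :
    criticalLength κ τ (radius κ r) = profileLength κ τ r := by
  rcases lt_trichotomy κ 0 with h | h | h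
  · set k := Real.sqrt (-κ) with hk
    have hk0 : 0 < k := Real.sqrt_pos.2 (by linarith)
    have hk2 : k ^ 2 = -κ := Real.sq_sqrt (by linarith)
    have hx1 : r * k / 2 < 1 := by
      by_contra! hcon
      nlinarith
    have hx : r * k / 2 ∈ Ioo (-1 : ℝ) 1 := ⟨by nlinarith, hx1⟩
    have hρ : radius κ r * k = 2 * Real.artanh (r * k / 2) := by
      rw [radius, if_pos h, ← hk]; field_simp
    rw [criticalLength, if_pos h, ← hk, hρ, mul_div_cancel_left₀ _ two_ne_zero, Real.tanh_artanh hx,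
      Real.sinh_two_mul, Real.sinh_artanh hx, Real.cosh_artanh hx]
    have hd : 0 < 1 - (r * k / 2) ^ 2 := by nlinarith
    have hsq : Real.sqrt (-κ + 4 * τ ^ 2 * (r * k / 2) ^ 2)
        = k * Real.sqrt (1 + τ ^ 2 * r ^ 2) := by
      rw [← hk2, show k ^ 2 + 4 * τ ^ 2 * (r * k / 2) ^ 2 = k ^ 2 * (1 + τ ^ 2 * r ^ 2) by ring,
        Real.sqrt_mul (by positivity), Real.sqrt_sq hk0.le]
    rw [hsq, profileLength, bigR, ← hk2, show κ = -k ^ 2 by linarith]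
    have hsd : Real.sqrt (1 - (r * k / 2) ^ 2) * Real.sqrt (1 - (r * k / 2) ^ 2)
      = 1 - (r * k / 2) ^ 2 := Real.mul_self_sqrt hd.le
    have hdiv : ∀ S D : ℝ, S * S = D → 2 * (r * k / 2 / S) * (1 / S) = r * k / D := by
      rintro S _ rfl; ring
    rw [hdiv _ _ hsd]
    have h4 : 4 + -k ^ 2 * r ^ 2 ≠ 0 := by nlinarith
    have h5 : 1 - (r * k / 2) ^ 2 ≠ 0 := hd.ne'
    have h6 : 1 - (r * k / 2) ^ 2 = (4 + -k ^ 2 * r ^ 2) / 4 := by ring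
    rw [h6]
    field_simp
  · subst h
    simp [criticalLength, radius, profileLength, bigR]
  · set k := Real.sqrt κ with hk
    have hk0 : 0 < k := Real.sqrt_pos.2 h
    have hk2 : k ^ 2 = κ := Real.sq_sqrt h.le
    have hn : ¬ κ < 0 := h.not_gt
    have hρ : radius κ r * k = 2 * Real.arctan (r * k / 2) := by
      rw [radius, if_neg hn, if_neg h.ne', ← hk]; field_simp
    rw [criticalLength, if_neg hn, if_neg h.ne', ← hk, hρ, mul_div_cancel_left₀ _ two_ne_zero,
      Real.tan_arctan, Real.sin_two_mul, Real.sin_arctan, Real.cos_arctan]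
    have hd : 0 < 1 + (r * k / 2) ^ 2 := by positivity
    have hsq : Real.sqrt (κ + 4 * τ ^ 2 * (r * k / 2) ^ 2)
        = k * Real.sqrt (1 + τ ^ 2 * r ^ 2) := by
      rw [← hk2, show k ^ 2 + 4 * τ ^ 2 * (r * k / 2) ^ 2 = k ^ 2 * (1 + τ ^ 2 * r ^ 2) by ring,
        Real.sqrt_mul (by positivity), Real.sqrt_sq hk0.le]
    rw [hsq, profileLength, bigR, ← hk2]
    have hsd : Real.sqrt (1 + (r * k / 2) ^ 2) * Real.sqrt (1 + (r * k / 2) ^ 2)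
      = 1 + (r * k / 2) ^ 2 := Real.mul_self_sqrt hd.le
    have hdiv : ∀ S D : ℝ, S * S = D → 2 * (r * k / 2 / S) * (1 / S) = r * k / D := by
      rintro S _ rfl; ring
    rw [hdiv _ _ hsd]
    have h6 : 1 + (r * k / 2) ^ 2 = (4 + k ^ 2 * r ^ 2) / 4 := by ring
    rw [h6]
    field_simp

/-! ## Calculus in two variables -/

section TwoVariables

variable {F : Type*} [NormedAddCommGroup F] [NormedSpace ℝ F]

lemma hasDerivAt_pair_fst (e t : ℝ) :
    HasDerivAt (fun x : ℝ => (![x, t] : Fin 2 → ℝ)) (Pi.single 0 1) e := by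
  rw [hasDerivAt_pi, Fin.forall_fin_two]
  exact ⟨by simpa using hasDerivAt_id' e, by simpa using hasDerivAt_const e t⟩

lemma hasDerivAt_pair_snd (e t : ℝ) :
    HasDerivAt (fun x : ℝ => (![e, x] : Fin 2 → ℝ)) (Pi.single 1 1) t := by
  rw [hasDerivAt_pi, Fin.forall_fin_two]
  exact ⟨by simpa using hasDerivAt_const t e, by simpa using hasDerivAt_id' t⟩

lemma hasDerivAt_fst {f : (Fin 2 → ℝ) → F} {e t : ℝ} (hf : DifferentiableAt ℝ f ![e, t]) :
    HasDerivAt (fun x => f ![x, t]) (pd 0 f ![e, t]) e :=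
  hf.hasFDerivAt.comp_hasDerivAt e (hasDerivAt_pair_fst e t)

lemma hasDerivAt_snd {f : (Fin 2 → ℝ) → F} {e t : ℝ} (hf : DifferentiableAt ℝ f ![e, t]) :
    HasDerivAt (fun x => f ![e, x]) (pd 1 f ![e, t]) t :=
  hf.hasFDerivAt.comp_hasDerivAt t (hasDerivAt_pair_snd e t)

lemma continuous_pair : Continuous (fun p : ℝ × ℝ => (![p.1, p.2] : Fin 2 → ℝ)) := by
  refine continuous_pi fun i => ?_
  revert i
  rw [Fin.forall_fin_two]
  exact ⟨by simpa using continuous_fst, by simpa using continuous_snd⟩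

lemma continuous_pair_snd (e : ℝ) : Continuous (fun x : ℝ => (![e, x] : Fin 2 → ℝ)) :=
  continuous_iff_continuousAt.2 fun t => (hasDerivAt_pair_snd e t).continuousAt

lemma contDiff_pair_snd (e : ℝ) : ContDiff ℝ ∞ (fun x : ℝ => (![e, x] : Fin 2 → ℝ)) := by
  rw [contDiff_pi, Fin.forall_fin_two]
  exact ⟨by simpa using contDiff_const, by simpa using contDiff_fun_id⟩

lemma contDiffOn_pd {n : ℕ} {f : (Fin n → ℝ) → F} {U : Set (Fin n → ℝ)} (hU : IsOpen U)
    (hf : ContDiffOn ℝ ∞ f U) (i : Fin n) : ContDiffOn ℝ ∞ (pd i f) U :=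
  (hf.fderiv_of_isOpen hU (m := ∞) (by simp)).clm_apply contDiffOn_const

lemma differentiableAt_of_contDiffOn {n : ℕ} {f : (Fin n → ℝ) → F} {U : Set (Fin n → ℝ)}
    (hU : IsOpen U) (hf : ContDiffOn ℝ ∞ f U) {x : Fin n → ℝ} (hx : x ∈ U) :
    DifferentiableAt ℝ f x :=
  (hf.contDiffAt (hU.mem_nhds hx)).differentiableAt (by simp)

lemma pd_comm {n : ℕ} {f : (Fin n → ℝ) → F} {U : Set (Fin n → ℝ)} (hU : IsOpen U)
    (hf : ContDiffOn ℝ ∞ f U) {x : Fin n → ℝ} (hx : x ∈ U) (i j : Fin n) :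
    pd i (pd j f) x = pd j (pd i f) x := by
  have hd : DifferentiableAt ℝ (fderiv ℝ f) x :=
    differentiableAt_of_contDiffOn hU (hf.fderiv_of_isOpen hU (m := ∞) (by simp)) hx
  have hs : IsSymmSndFDerivAt ℝ f x :=
    (hf.contDiffAt (hU.mem_nhds hx)).isSymmSndFDerivAt
      (by simpa using (show (2 : ℕ∞ω) ≤ ∞ from ENat.LEInfty.out))
  have h (i j : Fin n) : pd i (pd j f) x
      = fderiv ℝ (fderiv ℝ f) x (Pi.single i 1) (Pi.single j 1) := by
    unfold pd
    rw [fderiv_clm_apply hd (differentiableAt_const _)]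
    simp
  rw [h, h, hs.eq]

variable {U : Set (Fin 2 → ℝ)} {L : ℝ}

/-- The tube lemma. It is needed because the profile curves are known to stay in the model only for
t in [0, L]. -/
lemma eventually_slice_subset (hU : IsOpen U) {e : ℝ} (h : ∀ t ∈ Icc 0 L, ![e, t] ∈ U) :
    ∀ᶠ x in nhds e, ∀ t ∈ Icc 0 L, ![x, t] ∈ U := by
  refine isCompact_Icc.eventually_forall_of_forall_eventually fun t ht => ?_
  exact (hU.preimage continuous_pair).mem_nhds (h t ht)

lemma continuousOn_slice {f : (Fin 2 → ℝ) → ℝ} {e : ℝ} (hf : ContinuousOn f U)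
    (h : ∀ t ∈ Icc 0 L, ![e, t] ∈ U) : ContinuousOn (fun t => f ![e, t]) (Icc 0 L) :=
  hf.comp (continuous_pair_snd e).continuousOn h

/-- Differentiation under the integral sign. -/
lemma hasDerivAt_integral_slice {f : (Fin 2 → ℝ) → ℝ} (hL : 0 ≤ L) (hU : IsOpen U)
    (hf : ContDiffOn ℝ ∞ f U) {e : ℝ} (h : ∀ t ∈ Icc 0 L, ![e, t] ∈ U) :
    HasDerivAt (fun x => ∫ t in (0 : ℝ)..L, f ![x, t])
      (∫ t in (0 : ℝ)..L, pd 0 f ![e, t]) e := by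
  obtain ⟨η, hη, hball⟩ := Metric.eventually_nhds_iff_ball.1 (eventually_slice_subset hU h)
  have hf' := contDiffOn_pd hU hf 0
  -- On this compact box the partial derivative is continuous, hence bounded by a constant, which
  -- serves as the dominating function.
  set K : Set (ℝ × ℝ) := Metric.closedBall e (η / 2) ×ˢ Icc 0 L
  have hK : IsCompact K := (isCompact_closedBall _ _).prod isCompact_Icc
  have hsub : Metric.closedBall e (η / 2) ⊆ Metric.ball e η :=
    Metric.closedBall_subset_ball (by linarith)
  have hcont : ContinuousOn (fun p : ℝ × ℝ => pd 0 f ![p.1, p.2]) K :=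
    hf'.continuousOn.comp continuous_pair.continuousOn fun p hp => hball _ (hsub hp.1) _ hp.2
  obtain ⟨C, hC⟩ := hK.exists_bound_of_continuousOn hcont
  have hIoc : ∀ t ∈ uIoc 0 L, t ∈ Icc 0 L := by
    intro t ht; rw [uIoc_of_le hL] at ht; exact Ioc_subset_Icc_self ht
  have hmeas : ∀ {g : (Fin 2 → ℝ) → ℝ}, ContDiffOn ℝ ∞ g U → ∀ x ∈ Metric.ball e η,
      IntervalIntegrable (fun t => g ![x, t]) MeasureTheory.volume 0 L := by
    intro g hg x hx
    apply ContinuousOn.intervalIntegrable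
    rw [uIcc_of_le hL]
    exact continuousOn_slice hg.continuousOn (hball x hx)
  have he := Metric.mem_ball_self (x := e) hη
  refine (intervalIntegral.hasDerivAt_integral_of_dominated_loc_of_deriv_le (bound := fun _ => C)
    (F := fun x t => f ![x, t]) (F' := fun x t => pd 0 f ![x, t])
    (Metric.closedBall_mem_nhds e (by linarith : 0 < η / 2)) ?_ (hmeas hf e he)
    (hmeas hf' e he).def'.aestronglyMeasurable ?_ intervalIntegrable_const ?_).2
  · filter_upwards [Metric.ball_mem_nhds e hη] with x hx
      using (hmeas hf x hx).def'.aestronglyMeasurable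
  · exact Filter.Eventually.of_forall fun t ht x hx => hC (x, t) ⟨hx, hIoc t ht⟩
  · exact Filter.Eventually.of_forall fun t ht x hx =>
      hasDerivAt_fst (differentiableAt_of_contDiffOn hU hf (hball x (hsub hx) t (hIoc t ht)))

end TwoVariables

/-! ## Axially symmetric variations -/

section Variation

/-- The profile curves of the surfaces `Ψ e`, as a function of `(e, t)`. -/
def profileCurve (Ψ : ℝ → (Fin 2 → ℝ) → (Fin 3 → ℝ)) (x : Fin 2 → ℝ) : Fin 3 → ℝ :=
  Ψ (x 0) ![0, x 1]

/-- The squared coordinate radius of the profile curves. -/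
def profileSq (Ψ : ℝ → (Fin 2 → ℝ) → (Fin 3 → ℝ)) (x : Fin 2 → ℝ) : ℝ :=
  profileCurve Ψ x 0 ^ 2 + profileCurve Ψ x 1 ^ 2

/-- The height of the profile curves. -/
def profileHeight (Ψ : ℝ → (Fin 2 → ℝ) → (Fin 3 → ℝ)) (x : Fin 2 → ℝ) : ℝ :=
  profileCurve Ψ x 2

/-- The area enclosed by the orbits of the points of the profile curves, divided by `π`. -/
def profileArea (κ : ℝ) (Ψ : ℝ → (Fin 2 → ℝ) → (Fin 3 → ℝ)) (x : Fin 2 → ℝ) : ℝ :=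
  sigma κ (profileCurve Ψ x) * profileSq Ψ x

/-- The square of the area density of the profile curves. -/
def profileDensitySq (κ τ : ℝ) (Ψ : ℝ → (Fin 2 → ℝ) → (Fin 3 → ℝ)) (x : Fin 2 → ℝ) : ℝ :=
  (profileArea κ Ψ x - κ / 4 * profileArea κ Ψ x ^ 2) * pd 1 (profileHeight Ψ) x ^ 2
    + (1 + τ ^ 2 * profileSq Ψ x) * pd 1 (profileArea κ Ψ) x ^ 2 * (1 / 4)

/-- The density of the swept volume. -/
def profileVolume (κ : ℝ) (Ψ : ℝ → (Fin 2 → ℝ) → (Fin 3 → ℝ)) (x : Fin 2 → ℝ) : ℝ :=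
  (pd 0 (profileArea κ Ψ) x * pd 1 (profileHeight Ψ) x
    - pd 0 (profileHeight Ψ) x * pd 1 (profileArea κ Ψ) x) * (1 / 2)

/-- The pairs `(e, t)` at which the profile curve lies in the model. -/
def profileDomain (κ δ : ℝ) (Ψ : ℝ → (Fin 2 → ℝ) → (Fin 3 → ℝ)) : Set (Fin 2 → ℝ) :=
  {x | x 0 ∈ Ioo (-δ) δ} ∩ {x | profileCurve Ψ x ∈ model κ}

variable {κ τ r L δ : ℝ} {Ψ : ℝ → (Fin 2 → ℝ) → (Fin 3 → ℝ)}

/-! ### Invariance of the metric and of determinants under rotations. -/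

lemma rotation_apply_zero (θ : ℝ) (p : Fin 3 → ℝ) :
    rotation θ p 0 = Real.cos θ * p 0 - Real.sin θ * p 1 := rfl

lemma rotation_apply_one (θ : ℝ) (p : Fin 3 → ℝ) :
    rotation θ p 1 = Real.sin θ * p 0 + Real.cos θ * p 1 := rfl

lemma rotation_apply_two (θ : ℝ) (p : Fin 3 → ℝ) : rotation θ p 2 = p 2 := rfl

lemma sigma_rotation (θ : ℝ) (p : Fin 3 → ℝ) : sigma κ (rotation θ p) = sigma κ p := by
  have h := Real.sin_sq_add_cos_sq θ
  simp only [sigma, rotation_apply_zero, rotation_apply_one]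
  congr 3
  linear_combination (p 0 ^ 2 + p 1 ^ 2) * h

/-- Rotations preserve x² + y², dx² + dy² and y dx - x dy, from which the metric is built. -/
lemma metric_rotation (θ : ℝ) (p v w : Fin 3 → ℝ) :
    metric κ τ (rotation θ p) (rotation θ v) (rotation θ w) = metric κ τ p v w := by
  have h := Real.sin_sq_add_cos_sq θ
  simp only [metric, sigma_rotation]
  simp only [rotation_apply_zero, rotation_apply_one, rotation_apply_two]
  generalize sigma κ p = s
  have h1 : (Real.sin θ * p 0 + Real.cos θ * p 1) * (Real.cos θ * v 0 - Real.sin θ * v 1)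
      - (Real.cos θ * p 0 - Real.sin θ * p 1) * (Real.sin θ * v 0 + Real.cos θ * v 1)
      = p 1 * v 0 - p 0 * v 1 := by linear_combination (p 1 * v 0 - p 0 * v 1) * h
  have h2 : (Real.sin θ * p 0 + Real.cos θ * p 1) * (Real.cos θ * w 0 - Real.sin θ * w 1)
      - (Real.cos θ * p 0 - Real.sin θ * p 1) * (Real.sin θ * w 0 + Real.cos θ * w 1)
      = p 1 * w 0 - p 0 * w 1 := by linear_combination (p 1 * w 0 - p 0 * w 1) * h
  rw [h1, h2]
  linear_combination s ^ 2 * (v 0 * w 0 + v 1 * w 1) * h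

lemma det_rows (u v w : Fin 3 → ℝ) : (Matrix.of ![u, v, w]).det
    = u 0 * v 1 * w 2 - u 0 * v 2 * w 1 - u 1 * v 0 * w 2 + u 1 * v 2 * w 0
      + u 2 * v 0 * w 1 - u 2 * v 1 * w 0 := by
  rw [Matrix.det_fin_three]; rfl

lemma det_rotation (θ : ℝ) (u v w : Fin 3 → ℝ) :
    (Matrix.of ![rotation θ u, rotation θ v, rotation θ w]).det = (Matrix.of ![u, v, w]).det := by
  have h := Real.sin_sq_add_cos_sq θ
  simp only [det_rows, rotation_apply_zero, rotation_apply_one, rotation_apply_two]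
  linear_combination (u 0 * v 1 * w 2 - u 0 * v 2 * w 1 - u 1 * v 0 * w 2 + u 1 * v 2 * w 0
    + u 2 * v 0 * w 1 - u 2 * v 1 * w 0) * h

lemma hasDerivAt_rotation_apply (θ : ℝ) {c : ℝ → Fin 3 → ℝ} {c' : Fin 3 → ℝ} {t : ℝ}
    (hc : HasDerivAt c c' t) : HasDerivAt (fun x => rotation θ (c x)) (rotation θ c') t := by
  rw [hasDerivAt_pi] at hc ⊢
  rw [forall_fin_three]
  exact ⟨((hc 0).const_mul _).sub ((hc 1).const_mul _),
    ((hc 0).const_mul _).add ((hc 1).const_mul _), hc 2⟩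

lemma hasDerivAt_rotation_div (R s : ℝ) (p : Fin 3 → ℝ) :
    HasDerivAt (fun x => rotation (x / R) p)
      (rotation (s / R) ((1 / R) • triple (-p 1) (p 0) 0)) s := by
  have hc : HasDerivAt (fun x => Real.cos (x / R)) (-Real.sin (s / R) * (1 / R)) s :=
    ((hasDerivAt_id s).div_const R).cos
  have hs : HasDerivAt (fun x => Real.sin (x / R)) (Real.cos (s / R) * (1 / R)) s :=
    ((hasDerivAt_id s).div_const R).sin
  rw [hasDerivAt_pi, forall_fin_three]
  refine ⟨((hc.mul_const (p 0)).sub (hs.mul_const (p 1))).congr_deriv ?_,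
    ((hs.mul_const (p 0)).add (hc.mul_const (p 1))).congr_deriv ?_,
    (hasDerivAt_const s (p 2)).congr_deriv ?_⟩ <;>
  simp [rotation, triple_zero, triple_one, triple_two] <;> ring

namespace IsAxialVariation

/-! ### Reduction of area and volume to the profile curve. -/

lemma eq_rotation (hΨ : IsAxialVariation κ τ r L δ Ψ) {e : ℝ} (he : e ∈ Ioo (-δ) δ) (s t : ℝ) :
    Ψ e ![s, t] = rotation (s / bigR κ r) (Ψ e ![0, t]) := by
  have := hΨ.axial e he 0 s t
  rwa [zero_add] at this

lemma contDiffOn_slice (hΨ : IsAxialVariation κ τ r L δ Ψ) (s : ℝ) :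
    ContDiffOn ℝ ∞ (fun x : Fin 2 → ℝ => Ψ (x 0) ![s, x 1]) {x | x 0 ∈ Ioo (-δ) δ} := by
  have h : ContDiff ℝ ∞ (fun x : Fin 2 → ℝ => (x 0, (![s, x 1] : Fin 2 → ℝ))) :=
    (contDiff_apply ℝ ℝ (0 : Fin 2)).prodMk
      ((contDiff_pair_snd s).comp (contDiff_apply ℝ ℝ (1 : Fin 2)))
  exact hΨ.smooth.comp h.contDiffOn fun x hx => ⟨hx, mem_univ _⟩

lemma contDiff_apply (hΨ : IsAxialVariation κ τ r L δ Ψ) {e : ℝ} (he : e ∈ Ioo (-δ) δ) :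
    ContDiff ℝ ∞ (Ψ e) := by
  rw [← contDiffOn_univ]
  exact hΨ.smooth.comp (contDiff_prodMk_right e).contDiffOn fun x _ => ⟨he, mem_univ _⟩

end IsAxialVariation

lemma isOpen_strip (δ : ℝ) : IsOpen {x : Fin 2 → ℝ | x 0 ∈ Ioo (-δ) δ} :=
  isOpen_Ioo.preimage (continuous_apply 0)

namespace IsAxialVariation

lemma contDiffOn_profileCurve (hΨ : IsAxialVariation κ τ r L δ Ψ) :
    ContDiffOn ℝ ∞ (profileCurve Ψ) {x | x 0 ∈ Ioo (-δ) δ} := hΨ.contDiffOn_slice 0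

lemma isOpen_profileDomain (hΨ : IsAxialVariation κ τ r L δ Ψ) :
    IsOpen (profileDomain κ δ Ψ) :=
  hΨ.contDiffOn_profileCurve.continuousOn.isOpen_inter_preimage (isOpen_strip δ) (isOpen_model κ)

lemma mem_profileDomain (hΨ : IsAxialVariation κ τ r L δ Ψ) {e t : ℝ} (he : e ∈ Ioo (-δ) δ)
    (ht : t ∈ Icc 0 L) : ![e, t] ∈ profileDomain κ δ Ψ :=
  ⟨he, hΨ.mem_model e he 0 t ht⟩

lemma contDiffOn_coord (hΨ : IsAxialVariation κ τ r L δ Ψ) (k : Fin 3) :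
    ContDiffOn ℝ ∞ (fun x => profileCurve Ψ x k) (profileDomain κ δ Ψ) :=
  contDiffOn_pi.1 (hΨ.contDiffOn_profileCurve.mono inter_subset_left) k

lemma contDiffOn_profileHeight (hΨ : IsAxialVariation κ τ r L δ Ψ) :
    ContDiffOn ℝ ∞ (profileHeight Ψ) (profileDomain κ δ Ψ) := hΨ.contDiffOn_coord 2

lemma contDiffOn_profileSq (hΨ : IsAxialVariation κ τ r L δ Ψ) :
    ContDiffOn ℝ ∞ (profileSq Ψ) (profileDomain κ δ Ψ) :=
  ((hΨ.contDiffOn_coord 0).pow 2).add ((hΨ.contDiffOn_coord 1).pow 2)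

lemma contDiffOn_profileArea (hΨ : IsAxialVariation κ τ r L δ Ψ) :
    ContDiffOn ℝ ∞ (profileArea κ Ψ) (profileDomain κ δ Ψ) := by
  refine ContDiffOn.mul ?_ hΨ.contDiffOn_profileSq
  exact contDiffOn_const.div (contDiffOn_const.add (contDiffOn_const.mul hΨ.contDiffOn_profileSq))
    fun x hx => ne_of_gt hx.2

lemma contDiffOn_profileDensitySq (hΨ : IsAxialVariation κ τ r L δ Ψ) :
    ContDiffOn ℝ ∞ (profileDensitySq κ τ Ψ) (profileDomain κ δ Ψ) := by
  have hU := hΨ.isOpen_profileDomain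
  have h1 := hΨ.contDiffOn_profileArea
  have h2 := contDiffOn_pd hU h1 1
  have h3 := contDiffOn_pd hU hΨ.contDiffOn_profileHeight 1
  exact ((h1.sub (contDiffOn_const.mul (h1.pow 2))).mul (h3.pow 2)).add
    (((contDiffOn_const.add (contDiffOn_const.mul hΨ.contDiffOn_profileSq)).mul (h2.pow 2)).mul
      contDiffOn_const)

lemma contDiffOn_profileVolume (hΨ : IsAxialVariation κ τ r L δ Ψ) :
    ContDiffOn ℝ ∞ (profileVolume κ Ψ) (profileDomain κ δ Ψ) := by
  have hU := hΨ.isOpen_profileDomain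
  have h1 := hΨ.contDiffOn_profileArea
  have h2 := hΨ.contDiffOn_profileHeight
  exact (((contDiffOn_pd hU h1 0).mul (contDiffOn_pd hU h2 1)).sub
    ((contDiffOn_pd hU h2 0).mul (contDiffOn_pd hU h1 1))).mul contDiffOn_const

/-- Implicit differentiation of Y(4 + κP) = 4P with P = x² + y²; in other words dY = σ² dP. -/
lemma pd_profileArea (hΨ : IsAxialVariation κ τ r L δ Ψ) {x : Fin 2 → ℝ}
    (hx : x ∈ profileDomain κ δ Ψ) (i : Fin 2) :
    pd i (profileArea κ Ψ) x = 2 * sigma κ (profileCurve Ψ x) ^ 2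
      * (profileCurve Ψ x 0 * pd i (profileCurve Ψ) x 0
        + profileCurve Ψ x 1 * pd i (profileCurve Ψ) x 1) := by
  have hU := hΨ.isOpen_profileDomain
  have hA := differentiableAt_of_contDiffOn hU hΨ.contDiffOn_profileArea hx
  have h0 := differentiableAt_of_contDiffOn hU (hΨ.contDiffOn_coord 0) hx
  have h1 := differentiableAt_of_contDiffOn hU (hΨ.contDiffOn_coord 1) hx
  have hd : DifferentiableAt ℝ (profileCurve Ψ) x := differentiableAt_of_contDiffOn (isOpen_strip δ)
    hΨ.contDiffOn_profileCurve hx.1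
  rw [pd_apply hd, pd_apply hd]
  have key : pd i (fun y => profileArea κ Ψ y
      * (4 + κ * (profileCurve Ψ y 0 ^ 2 + profileCurve Ψ y 1 ^ 2))
      - 4 * (profileCurve Ψ y 0 ^ 2 + profileCurve Ψ y 1 ^ 2)) x = 0 := by
    rw [pd_congr (g := fun _ => (0 : ℝ)), pd_const]
    filter_upwards [hU.mem_nhds hx] with y hy
    have := sigma_mul hy.2
    rw [profileArea, profileSq]
    linear_combination (profileCurve Ψ y 0 ^ 2 + profileCurve Ψ y 1 ^ 2) * this
  simp (disch := first | assumption | fun_prop (disch := assumption)) only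
    [pd_mul, pd_add, pd_sub, pd_pow, pd_const] at key
  have hs := sigma_mul hx.2
  have hA' : profileArea κ Ψ x
      = sigma κ (profileCurve Ψ x) * (profileCurve Ψ x 0 ^ 2 + profileCurve Ψ x 1 ^ 2) := rfl
  rw [hA'] at key
  generalize sigma κ (profileCurve Ψ x) = s at *
  generalize pd i (profileArea κ Ψ) x = Y' at *
  norm_num at key
  linear_combination (s / 4) * key - (Y' / 4) * hs
    - s / 2 * (profileCurve Ψ x 0 * pd i (fun x => profileCurve Ψ x 0) x
      + profileCurve Ψ x 1 * pd i (fun x => profileCurve Ψ x 1) x) * hs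

lemma hasDerivAt_profileCurve_zero (hΨ : IsAxialVariation κ τ r L δ Ψ) {e : ℝ}
    (he : e ∈ Ioo (-δ) δ) (t : ℝ) :
    HasDerivAt (fun x => Ψ x ![0, t]) (pd 0 (profileCurve Ψ) ![e, t]) e :=
  hasDerivAt_fst (differentiableAt_of_contDiffOn (isOpen_strip δ) hΨ.contDiffOn_profileCurve
    (x := ![e, t]) he)

lemma hasDerivAt_profileCurve_one (hΨ : IsAxialVariation κ τ r L δ Ψ) {e : ℝ}
    (he : e ∈ Ioo (-δ) δ) (t : ℝ) :
    HasDerivAt (fun x => Ψ e ![0, x]) (pd 1 (profileCurve Ψ) ![e, t]) t :=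
  hasDerivAt_snd (differentiableAt_of_contDiffOn (isOpen_strip δ) hΨ.contDiffOn_profileCurve
    (x := ![e, t]) he)

lemma deriv_eq (hΨ : IsAxialVariation κ τ r L δ Ψ) {e : ℝ} (he : e ∈ Ioo (-δ) δ) (s t : ℝ) :
    deriv (fun x => Ψ x ![s, t]) e
      = rotation (s / bigR κ r) (pd 0 (profileCurve Ψ) ![e, t]) := by
  refine HasDerivAt.deriv ((hasDerivAt_rotation_apply _
    (hΨ.hasDerivAt_profileCurve_zero he t)).congr_of_eventuallyEq ?_)
  filter_upwards [isOpen_Ioo.mem_nhds he] with x hx using hΨ.eq_rotation hx s t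

lemma pd_zero_eq (hΨ : IsAxialVariation κ τ r L δ Ψ) {e : ℝ} (he : e ∈ Ioo (-δ) δ) (s t : ℝ) :
    pd 0 (Ψ e) ![s, t] = rotation (s / bigR κ r)
      ((1 / bigR κ r) • triple (-profileCurve Ψ ![e, t] 1) (profileCurve Ψ ![e, t] 0) 0) := by
  have h := hasDerivAt_fst (e := s) (t := t) ((hΨ.contDiff_apply he).differentiable (by simp) _)
  exact (h.congr_of_eventuallyEq (Filter.Eventually.of_forall fun x =>
    (hΨ.eq_rotation he x t).symm)).unique (hasDerivAt_rotation_div _ _ _)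

lemma pd_one_eq (hΨ : IsAxialVariation κ τ r L δ Ψ) {e : ℝ} (he : e ∈ Ioo (-δ) δ) (s t : ℝ) :
    pd 1 (Ψ e) ![s, t] = rotation (s / bigR κ r) (pd 1 (profileCurve Ψ) ![e, t]) := by
  have h := hasDerivAt_snd (e := s) (t := t) ((hΨ.contDiff_apply he).differentiable (by simp) _)
  exact (h.congr_of_eventuallyEq (Filter.Eventually.of_forall fun x =>
    (hΨ.eq_rotation he s x).symm)).unique
    (hasDerivAt_rotation_apply _ (hΨ.hasDerivAt_profileCurve_one he t))

/-- By rotation invariance it suffices to take the Gram determinant of the rotation field, divided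
by R, and the tangent of the profile curve. The coefficient of z_t² is σ²P, which equals Y - κY²/4
because σ = 1 - κY/4. -/
lemma areaDensity_eq (hΨ : IsAxialVariation κ τ r L δ Ψ) (hR : 0 < bigR κ r) {e : ℝ}
    (he : e ∈ Ioo (-δ) δ) (s : ℝ) {t : ℝ} (ht : ![e, t] ∈ profileDomain κ δ Ψ) :
    areaDensity κ τ (Ψ e) ![s, t]
      = Real.sqrt (profileDensitySq κ τ Ψ ![e, t]) / bigR κ r := by
  have hdet : (firstForm κ τ (Ψ e) ![s, t]).det
      = profileDensitySq κ τ Ψ ![e, t] / bigR κ r ^ 2 := by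
    have hz : pd 1 (profileHeight Ψ) ![e, t] = pd 1 (profileCurve Ψ) ![e, t] 2 :=
      (pd_apply (differentiableAt_of_contDiffOn (isOpen_strip δ) hΨ.contDiffOn_profileCurve
        (x := ![e, t]) he) 1 2).symm
    rw [Matrix.det_fin_two]
    simp only [firstForm, Matrix.of_apply, hΨ.pd_zero_eq he, hΨ.pd_one_eq he]
    rw [hΨ.eq_rotation he]
    simp only [metric_rotation]
    rw [profileDensitySq, hΨ.pd_profileArea ht, hz, profileArea, profileSq]
    have hc : Ψ e ![0, t] = profileCurve Ψ ![e, t] := rfl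
    have hs := sigma_mul ht.2
    rw [hc]
    simp only [metric, Pi.smul_apply, smul_eq_mul, triple_zero, triple_one, triple_two]
    generalize profileCurve Ψ ![e, t] = c at *
    generalize pd 1 (profileCurve Ψ) ![e, t] = d at *
    generalize sigma κ c = σ at *
    generalize bigR κ r = R at *
    linear_combination (σ * (c 0 ^ 2 + c 1 ^ 2) / 4 * d 2 ^ 2 * R⁻¹ ^ 2) * hs
  rw [areaDensity, hdet, Real.sqrt_div' _ (by positivity), Real.sqrt_sq hR.le]

/-- The volume form is σ² dx dy dz, that is dY dθ dz / 2 in terms of the enclosed area; τ does not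
enter. -/
lemma volumeDensity_eq (hΨ : IsAxialVariation κ τ r L δ Ψ) {e : ℝ}
    (he : e ∈ Ioo (-δ) δ) (s : ℝ) {t : ℝ} (ht : ![e, t] ∈ profileDomain κ δ Ψ) :
    Real.sqrt (metricMatrix κ τ (Ψ e ![s, t])).det *
      (Matrix.of ![deriv (fun x => Ψ x ![s, t]) e, pd 0 (Ψ e) ![s, t], pd 1 (Ψ e) ![s, t]]).det
      = profileVolume κ Ψ ![e, t] / bigR κ r := by
  have hd := differentiableAt_of_contDiffOn (isOpen_strip δ) hΨ.contDiffOn_profileCurve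
    (x := ![e, t]) he
  have hz (i : Fin 2) : pd i (profileHeight Ψ) ![e, t] = pd i (profileCurve Ψ) ![e, t] 2 :=
    (pd_apply hd i 2).symm
  rw [hΨ.deriv_eq he, hΨ.pd_zero_eq he, hΨ.pd_one_eq he, det_rotation, metricMatrix_det,
    hΨ.eq_rotation he, sigma_rotation, show ∀ x : ℝ, x ^ 4 = (x ^ 2) ^ 2 by intro x; ring,
    Real.sqrt_sq (sq_nonneg _), profileVolume, hΨ.pd_profileArea ht, hΨ.pd_profileArea ht, hz, hz]
  have hc : Ψ e ![0, t] = profileCurve Ψ ![e, t] := rfl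
  rw [hc]
  simp only [det_rows, Pi.smul_apply, smul_eq_mul, triple_zero, triple_one, triple_two]
  ring

lemma area_eq (hΨ : IsAxialVariation κ τ r L δ Ψ) (hL : 0 ≤ L) (hR : 0 < bigR κ r) {e : ℝ}
    (he : e ∈ Ioo (-δ) δ) : area κ τ r L Ψ e
      = 2 * Real.pi * ∫ t in (0 : ℝ)..L, Real.sqrt (profileDensitySq κ τ Ψ ![e, t]) := by
  have h (s : ℝ) : ∫ t in (0 : ℝ)..L, (1 : ℝ) * areaDensity κ τ (Ψ e) ![s, t]
      = (∫ t in (0 : ℝ)..L, Real.sqrt (profileDensitySq κ τ Ψ ![e, t])) / bigR κ r := by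
    rw [← intervalIntegral.integral_div]
    refine intervalIntegral.integral_congr fun t ht => ?_
    rw [uIcc_of_le hL] at ht
    simp only [one_mul, hΨ.areaDensity_eq hR he s (hΨ.mem_profileDomain he ht)]
  simp only [area, surfaceIntegral, h, intervalIntegral.integral_const, smul_eq_mul, sub_zero]
  field_simp

lemma sweptVolume_eq (hΨ : IsAxialVariation κ τ r L δ Ψ) (hL : 0 ≤ L) (hR : 0 < bigR κ r) {e : ℝ}
    (he : e ∈ Ioo (-δ) δ) : sweptVolume κ τ r L Ψ e
      = 2 * Real.pi * ∫ h in (0 : ℝ)..e, ∫ t in (0 : ℝ)..L, profileVolume κ Ψ ![h, t] := by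
  rw [← intervalIntegral.integral_const_mul]
  refine intervalIntegral.integral_congr fun h hh => ?_
  have h0 : (0 : ℝ) ∈ Ioo (-δ) δ := by
    constructor <;> linarith [he.1, he.2]
  have hh' : h ∈ Ioo (-δ) δ := (ordConnected_Ioo.uIcc_subset h0 he) hh
  have key (s : ℝ) : ∫ t in (0 : ℝ)..L, Real.sqrt (metricMatrix κ τ (Ψ h ![s, t])).det *
      (Matrix.of ![deriv (fun x => Ψ x ![s, t]) h, pd 0 (Ψ h) ![s, t], pd 1 (Ψ h) ![s, t]]).det
      = (∫ t in (0 : ℝ)..L, profileVolume κ Ψ ![h, t]) / bigR κ r := by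
    rw [← intervalIntegral.integral_div]
    refine intervalIntegral.integral_congr fun t ht => ?_
    rw [uIcc_of_le hL] at ht
    exact hΨ.volumeDensity_eq hh' s (hΨ.mem_profileDomain hh' ht)
  simp only [key, intervalIntegral.integral_const, smul_eq_mul, sub_zero]
  field_simp

end IsAxialVariation

end Variation

/-! ## The second variation formula -/

section SecondVariation

/-- In the application Z = z_t, T = Y_t and D = √W. The identity D² = W is differentiated twice in e
instead of the square root. Only e-derivatives occur, so Z and T can be treated as unrelated to Y,
and the values Z = 1, Z_e = 0, T = 0 on the cylinder remove most terms. -/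
lemma pd_pd_density {U : Set (Fin 2 → ℝ)} (hU : IsOpen U) {Y Z T P D : (Fin 2 → ℝ) → ℝ}
    {κ τ : ℝ} (hY : ContDiffOn ℝ ∞ Y U) (hZ : ContDiffOn ℝ ∞ Z U) (hT : ContDiffOn ℝ ∞ T U)
    (hP : ContDiffOn ℝ ∞ P U) (hD : ContDiffOn ℝ ∞ D U)
    (hW : ∀ y ∈ U, D y * D y
      = (Y y - κ / 4 * Y y ^ 2) * Z y ^ 2 + (1 + τ ^ 2 * P y) * T y ^ 2 * (1 / 4))
    {x : Fin 2 → ℝ} (hx : x ∈ U) (hZx : Z x = 1) (hZx' : pd 0 Z x = 0) (hTx : T x = 0) :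
    2 * D x * pd 0 D x = (1 - κ / 2 * Y x) * pd 0 Y x ∧
    2 * pd 0 D x ^ 2 + 2 * D x * pd 0 (pd 0 D) x
      = (1 - κ / 2 * Y x) * pd 0 (pd 0 Y) x - κ / 2 * pd 0 Y x ^ 2
        + 2 * (Y x - κ / 4 * Y x ^ 2) * pd 0 (pd 0 Z) x
        + (1 + τ ^ 2 * P x) * pd 0 T x ^ 2 * (1 / 2) := by
  have hd {f : (Fin 2 → ℝ) → ℝ} (hf : ContDiffOn ℝ ∞ f U) :
      ∀ y ∈ U, DifferentiableAt ℝ f y := fun y hy => differentiableAt_of_contDiffOn hU hf hy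
  have hd' {f : (Fin 2 → ℝ) → ℝ} (hf : ContDiffOn ℝ ∞ f U) :
      ∀ y ∈ U, DifferentiableAt ℝ (pd 0 f) y := hd (contDiffOn_pd hU hf 0)
  have first : ∀ y ∈ U, D y * pd 0 D y + pd 0 D y * D y
      = (Y y - κ / 4 * Y y ^ 2) * (2 * Z y * pd 0 Z y)
        + (pd 0 Y y - κ / 4 * (2 * Y y * pd 0 Y y)) * Z y ^ 2
        + ((1 + τ ^ 2 * P y) * (2 * T y * pd 0 T y) + τ ^ 2 * pd 0 P y * T y ^ 2) * (1 / 4) := by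
    intro y hy
    have := hd hY y hy
    have := hd hZ y hy
    have := hd hT y hy
    have := hd hP y hy
    have := hd hD y hy
    have h : pd 0 (fun y => D y * D y) y = pd 0 (fun y => (Y y - κ / 4 * Y y ^ 2) * Z y ^ 2
        + (1 + τ ^ 2 * P y) * T y ^ 2 * (1 / 4)) y := by
      apply pd_congr
      filter_upwards [hU.mem_nhds hy] with z hz using hW z hz
    simp (disch := first | assumption | fun_prop (disch := assumption)) only
      [pd_mul, pd_add, pd_sub, pd_pow, pd_const] at h
    norm_num at h
    linear_combination h
  have := hd hY x hx
  have := hd hZ x hx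
  have := hd hT x hx
  have := hd hP x hx
  have := hd hD x hx
  have := hd' hY x hx
  have := hd' hZ x hx
  have := hd' hT x hx
  have := hd' hP x hx
  have := hd' hD x hx
  have second : pd 0 (fun y => D y * pd 0 D y + pd 0 D y * D y) x
      = pd 0 (fun y => (Y y - κ / 4 * Y y ^ 2) * (2 * Z y * pd 0 Z y)
        + (pd 0 Y y - κ / 4 * (2 * Y y * pd 0 Y y)) * Z y ^ 2
        + ((1 + τ ^ 2 * P y) * (2 * T y * pd 0 T y) + τ ^ 2 * pd 0 P y * T y ^ 2) * (1 / 4)) x := by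
    apply pd_congr
    filter_upwards [hU.mem_nhds hx] with z hz using first z hz
  simp (disch := first | assumption | fun_prop (disch := assumption)) only
    [pd_mul, pd_add, pd_sub, pd_pow, pd_const, hZx, hZx', hTx] at second
  have first' := first x hx
  rw [hZx, hZx', hTx] at first'
  norm_num at second
  constructor
  · linear_combination first'
  · linear_combination second

lemma pd_volume {U : Set (Fin 2 → ℝ)} (hU : IsOpen U) {Y Z T z : (Fin 2 → ℝ) → ℝ}
    (hY : ContDiffOn ℝ ∞ Y U) (hZ : ContDiffOn ℝ ∞ Z U) (hT : ContDiffOn ℝ ∞ T U)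
    (hz : ContDiffOn ℝ ∞ z U) {x : Fin 2 → ℝ} (hx : x ∈ U) (hZx : Z x = 1) (hZx' : pd 0 Z x = 0)
    (hTx : T x = 0) (hzx : pd 0 z x = 0) :
    pd 0 (fun y => (pd 0 Y y * Z y - pd 0 z y * T y) * (1 / 2)) x = pd 0 (pd 0 Y) x / 2 := by
  have hd {f : (Fin 2 → ℝ) → ℝ} (hf : ContDiffOn ℝ ∞ f U) : DifferentiableAt ℝ f x :=
    differentiableAt_of_contDiffOn hU hf hx
  have := hd hZ
  have := hd hT
  have := hd (contDiffOn_pd hU hY 0)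
  have := hd (contDiffOn_pd hU hz 0)
  simp (disch := first | assumption | fun_prop (disch := assumption)) only
    [pd_mul, pd_sub, pd_const, hZx, hZx', hTx, hzx]
  ring

variable {κ τ r L δ : ℝ} {Ψ : ℝ → (Fin 2 → ℝ) → (Fin 3 → ℝ)}

/-- The variation field of the enclosed area. -/
def profileField (κ : ℝ) (Ψ : ℝ → (Fin 2 → ℝ) → (Fin 3 → ℝ)) (t : ℝ) : ℝ :=
  pd 0 (profileArea κ Ψ) ![0, t]

namespace IsAxialVariation

/-! ### Values and derivatives of the profile data on the initial cylinder. -/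

lemma profileCurve_start (hΨ : IsAxialVariation κ τ r L δ Ψ) (t : ℝ) :
    profileCurve Ψ ![0, t] = triple r 0 t := by
  have : profileCurve Ψ ![0, t] = cylinder κ r ![0, t] := hΨ.start _
  rw [this]
  funext k
  revert k
  rw [forall_fin_three, cylinder_zero, cylinder_one, cylinder_two]
  simp [triple_zero, triple_one, triple_two]

lemma mem_profileDomain_start (hΨ : IsAxialVariation κ τ r L δ Ψ) (hδ : 0 < δ)
    (hκ : 0 < 4 + κ * r ^ 2) (t : ℝ) : ![0, t] ∈ profileDomain κ δ Ψ := by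
  refine ⟨⟨by simpa using hδ, by simpa using hδ⟩, ?_⟩
  change 0 < 4 + κ * (profileCurve Ψ ![0, t] 0 ^ 2 + profileCurve Ψ ![0, t] 1 ^ 2)
  rw [hΨ.profileCurve_start, triple_zero, triple_one]
  simpa using hκ

lemma profileSq_start (hΨ : IsAxialVariation κ τ r L δ Ψ) (t : ℝ) :
    profileSq Ψ ![0, t] = r ^ 2 := by
  rw [profileSq, hΨ.profileCurve_start, triple_zero, triple_one]; ring

lemma profileArea_start (hΨ : IsAxialVariation κ τ r L δ Ψ) (t : ℝ) :
    profileArea κ Ψ ![0, t] = r * bigR κ r := by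
  rw [profileArea, hΨ.profileSq_start, hΨ.profileCurve_start, sigma, triple_zero, triple_one, bigR]
  ring

lemma profileHeight_start (hΨ : IsAxialVariation κ τ r L δ Ψ) (t : ℝ) :
    profileHeight Ψ ![0, t] = t := by
  rw [profileHeight, hΨ.profileCurve_start, triple_two]

lemma pd_one_profileArea_start (hΨ : IsAxialVariation κ τ r L δ Ψ) (hδ : 0 < δ)
    (hκ : 0 < 4 + κ * r ^ 2) (t : ℝ) : pd 1 (profileArea κ Ψ) ![0, t] = 0 := by
  have h := hasDerivAt_snd (differentiableAt_of_contDiffOn hΨ.isOpen_profileDomain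
    hΨ.contDiffOn_profileArea (hΨ.mem_profileDomain_start hδ hκ t))
  simp only [hΨ.profileArea_start] at h
  exact h.unique (hasDerivAt_const _ _)

lemma pd_one_profileHeight_start (hΨ : IsAxialVariation κ τ r L δ Ψ) (hδ : 0 < δ)
    (hκ : 0 < 4 + κ * r ^ 2) (t : ℝ) : pd 1 (profileHeight Ψ) ![0, t] = 1 := by
  have h := hasDerivAt_snd (differentiableAt_of_contDiffOn hΨ.isOpen_profileDomain
    hΨ.contDiffOn_profileHeight (hΨ.mem_profileDomain_start hδ hκ t))
  simp only [hΨ.profileHeight_start] at h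
  exact h.unique (hasDerivAt_id' _)

/-- The variation field is a multiple of N, and N has no ∂z-component along the cylinder. -/
lemma pd_zero_profileHeight_start (hΨ : IsAxialVariation κ τ r L δ Ψ) (hδ : 0 < δ)
    {t : ℝ} (ht : t ∈ Icc 0 L) : pd 0 (profileHeight Ψ) ![0, t] = 0 := by
  have h0 : (0 : ℝ) ∈ Ioo (-δ) δ := ⟨by linarith, hδ⟩
  have hd := differentiableAt_of_contDiffOn (isOpen_strip δ) hΨ.contDiffOn_profileCurve
    (x := ![0, t]) h0
  obtain ⟨a, ha⟩ := hΨ.normal 0 t ht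
  have h := (hΨ.hasDerivAt_profileCurve_zero h0 t).deriv
  have hz : pd 0 (profileHeight Ψ) ![0, t] = pd 0 (profileCurve Ψ) ![0, t] 2 :=
    (pd_apply hd 0 2).symm
  rw [hz, ← h, ha, Pi.smul_apply, cylinderNormal_two, smul_zero]

lemma contDiff_profileField (hΨ : IsAxialVariation κ τ r L δ Ψ) (hδ : 0 < δ)
    (hκ : 0 < 4 + κ * r ^ 2) : ContDiff ℝ ∞ (profileField κ Ψ) := by
  rw [← contDiffOn_univ]
  exact (contDiffOn_pd hΨ.isOpen_profileDomain hΨ.contDiffOn_profileArea 0).comp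
    (contDiff_pair_snd 0).contDiffOn fun t _ => hΨ.mem_profileDomain_start hδ hκ t

lemma profileField_eq_zero (hΨ : IsAxialVariation κ τ r L δ Ψ) (hδ : 0 < δ)
    (hκ : 0 < 4 + κ * r ^ 2) {t : ℝ}
    (ht : ∀ e ∈ Ioo (-δ) δ, Ψ e ![0, t] = cylinder κ r ![0, t]) : profileField κ Ψ t = 0 := by
  have h := hasDerivAt_fst (differentiableAt_of_contDiffOn hΨ.isOpen_profileDomain
    hΨ.contDiffOn_profileArea (hΨ.mem_profileDomain_start hδ hκ t))
  refine (h.congr_of_eventuallyEq (f₁ := fun _ => profileArea κ Ψ ![0, t]) ?_).unique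
    (hasDerivAt_const _ _)
  filter_upwards [isOpen_Ioo.mem_nhds (show (0 : ℝ) ∈ Ioo (-δ) δ from ⟨by linarith, hδ⟩)] with e he
  have h1 : profileCurve Ψ ![e, t] = profileCurve Ψ ![0, t] :=
    (ht e he).trans (hΨ.start _).symm
  simp only [profileArea, profileSq, h1]

lemma pd_zero_pd_one_profileArea (hΨ : IsAxialVariation κ τ r L δ Ψ) (hδ : 0 < δ)
    (hκ : 0 < 4 + κ * r ^ 2) (t : ℝ) :
    pd 0 (pd 1 (profileArea κ Ψ)) ![0, t] = deriv (profileField κ Ψ) t := by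
  have hx := hΨ.mem_profileDomain_start hδ hκ t
  have hU := hΨ.isOpen_profileDomain
  rw [pd_comm hU hΨ.contDiffOn_profileArea hx]
  exact (hasDerivAt_snd (differentiableAt_of_contDiffOn hU
    (contDiffOn_pd hU hΨ.contDiffOn_profileArea 0) hx)).deriv.symm

lemma pd_zero_pd_one_profileHeight (hΨ : IsAxialVariation κ τ r L δ Ψ) (hδ : 0 < δ) (hL : 0 < L)
    (hκ : 0 < 4 + κ * r ^ 2) {t : ℝ} (ht : t ∈ Icc 0 L) :
    pd 0 (pd 1 (profileHeight Ψ)) ![0, t] = 0 := by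
  have hx := hΨ.mem_profileDomain_start hδ hκ t
  have hU := hΨ.isOpen_profileDomain
  rw [pd_comm hU hΨ.contDiffOn_profileHeight hx]
  have h := hasDerivAt_snd (differentiableAt_of_contDiffOn hU
    (contDiffOn_pd hU hΨ.contDiffOn_profileHeight 0) hx)
  -- Normality is assumed only on [0, L], so at the ends the derivative is identified through the
  -- one-sided one.
  have h2 : HasDerivWithinAt (fun t => pd 0 (profileHeight Ψ) ![0, t]) 0 (Icc 0 L) t :=
    (hasDerivWithinAt_const t _ (0 : ℝ)).congr
      (fun s hs => hΨ.pd_zero_profileHeight_start hδ hs) (hΨ.pd_zero_profileHeight_start hδ ht)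
  exact (uniqueDiffOn_Icc hL t ht).eq_deriv _ h.hasDerivWithinAt h2

/-- The fixed boundary gives ∫ z_t dt = L for every e; differentiate twice in e under the integral.
-/
lemma integral_pd_pd_height (hΨ : IsAxialVariation κ τ r L δ Ψ) (hδ : 0 < δ) (hL : 0 < L) :
    ∫ t in (0 : ℝ)..L, pd 0 (pd 0 (pd 1 (profileHeight Ψ))) ![0, t] = 0 := by
  have hU := hΨ.isOpen_profileDomain
  have hZ := contDiffOn_pd hU hΨ.contDiffOn_profileHeight 1
  have h0 : (0 : ℝ) ∈ Ioo (-δ) δ := ⟨by linarith, hδ⟩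
  have hconst : ∀ e ∈ Ioo (-δ) δ, ∫ t in (0 : ℝ)..L, pd 1 (profileHeight Ψ) ![e, t] = L := by
    intro e he
    have hmem : ∀ t ∈ Icc 0 L, ![e, t] ∈ profileDomain κ δ Ψ :=
      fun t ht => hΨ.mem_profileDomain he ht
    rw [intervalIntegral.integral_eq_sub_of_hasDerivAt (f := fun t => profileHeight Ψ ![e, t])]
    · have h1 : profileHeight Ψ ![e, L] = L := congrFun (hΨ.top e he 0) 2
      have h2 : profileHeight Ψ ![e, 0] = 0 := congrFun (hΨ.bottom e he 0) 2
      rw [h1, h2, sub_zero]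
    · intro t ht
      rw [uIcc_of_le hL.le] at ht
      exact hasDerivAt_snd (differentiableAt_of_contDiffOn hU hΨ.contDiffOn_profileHeight
        (hmem t ht))
    · apply ContinuousOn.intervalIntegrable
      rw [uIcc_of_le hL.le]
      exact continuousOn_slice hZ.continuousOn hmem
  have hzero : ∀ e ∈ Ioo (-δ) δ, ∫ t in (0 : ℝ)..L, pd 0 (pd 1 (profileHeight Ψ)) ![e, t] = 0 := by
    intro e he
    have h := hasDerivAt_integral_slice hL.le hU hZ fun t ht => hΨ.mem_profileDomain he ht
    refine (h.congr_of_eventuallyEq (f₁ := fun _ => L) ?_).unique (hasDerivAt_const _ _)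
    filter_upwards [isOpen_Ioo.mem_nhds he] with x hx using (hconst x hx).symm
  have h := hasDerivAt_integral_slice hL.le hU (contDiffOn_pd hU hZ 0)
    fun t ht => hΨ.mem_profileDomain h0 ht
  refine (h.congr_of_eventuallyEq (f₁ := fun _ => 0) ?_).unique (hasDerivAt_const _ _)
  filter_upwards [isOpen_Ioo.mem_nhds h0] with x hx using (hzero x hx).symm

lemma hasDerivAt_sweptVolume (hΨ : IsAxialVariation κ τ r L δ Ψ) (hL : 0 < L)
    (hR : 0 < bigR κ r) {e : ℝ} (he : e ∈ Ioo (-δ) δ) :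
    HasDerivAt (sweptVolume κ τ r L Ψ)
      (2 * Real.pi * ∫ t in (0 : ℝ)..L, profileVolume κ Ψ ![e, t]) e := by
  have hU := hΨ.isOpen_profileDomain
  have h0 : (0 : ℝ) ∈ Ioo (-δ) δ := by constructor <;> linarith [he.1, he.2]
  have hd : ∀ x ∈ Ioo (-δ) δ, ContinuousAt
      (fun x => ∫ t in (0 : ℝ)..L, profileVolume κ Ψ ![x, t]) x := fun x hx =>
    (hasDerivAt_integral_slice hL.le hU hΨ.contDiffOn_profileVolume
      fun t ht => hΨ.mem_profileDomain hx ht).continuousAt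
  have hc : ContinuousOn (fun x => ∫ t in (0 : ℝ)..L, profileVolume κ Ψ ![x, t]) (Ioo (-δ) δ) :=
    fun x hx => (hd x hx).continuousWithinAt
  have h := (intervalIntegral.integral_hasDerivAt_right
    ((hc.mono (ordConnected_Ioo.uIcc_subset h0 he)).intervalIntegrable)
    (hc.stronglyMeasurableAtFilter isOpen_Ioo e he) (hd e he)).const_mul (2 * Real.pi)
  refine h.congr_of_eventuallyEq ?_
  filter_upwards [isOpen_Ioo.mem_nhds he] with x hx using hΨ.sweptVolume_eq hL.le hR hx

lemma hasDerivAt_sweptVolume_zero (hΨ : IsAxialVariation κ τ r L δ Ψ) (hδ : 0 < δ) (hL : 0 < L)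
    (hκ : 0 < 4 + κ * r ^ 2) (hR : 0 < bigR κ r) :
    HasDerivAt (sweptVolume κ τ r L Ψ) (Real.pi * ∫ t in (0 : ℝ)..L, profileField κ Ψ t) 0 := by
  refine (hΨ.hasDerivAt_sweptVolume hL hR ⟨by linarith, hδ⟩).congr_deriv ?_
  have h (t : ℝ) : profileVolume κ Ψ ![0, t] = 1 / 2 * profileField κ Ψ t := by
    rw [profileVolume, hΨ.pd_one_profileArea_start hδ hκ, hΨ.pd_one_profileHeight_start hδ hκ,
      profileField]
    ring
  simp only [h, intervalIntegral.integral_const_mul]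
  ring

lemma profileDensitySq_start (hΨ : IsAxialVariation κ τ r L δ Ψ) (hδ : 0 < δ)
    (hκ : 0 < 4 + κ * r ^ 2) (t : ℝ) : profileDensitySq κ τ Ψ ![0, t] = bigR κ r ^ 2 := by
  rw [profileDensitySq, hΨ.pd_one_profileArea_start hδ hκ, hΨ.pd_one_profileHeight_start hδ hκ,
    hΨ.profileArea_start, bigR]
  field_simp
  ring

/-- The coefficient of Y_ee in the second derivative of √W is (4 - κr²)/(8r) = -H, and the volume
density contributes 2H · Y_ee/2, so Y_ee drops out. The other second-order quantity, z_eet, survives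
pointwise and disappears only after integration. -/
lemma second_derivative_integrand (hΨ : IsAxialVariation κ τ r L δ Ψ) (hδ : 0 < δ) (hr : 0 < r)
    (hκ : 0 < 4 + κ * r ^ 2) (hL : 0 < L) {U : Set (Fin 2 → ℝ)} (hU : IsOpen U)
    (hUs : U ⊆ profileDomain κ δ Ψ) (hpos : ∀ x ∈ U, 0 < profileDensitySq κ τ Ψ x) {t : ℝ}
    (ht : t ∈ Icc 0 L) (hx : ![0, t] ∈ U) :
    pd 0 (pd 0 fun x => Real.sqrt (profileDensitySq κ τ Ψ x)) ![0, t]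
      + 2 * (-((4 - κ * r ^ 2) / (8 * r))) * pd 0 (profileVolume κ Ψ) ![0, t]
      = bigR κ r * pd 0 (pd 0 (pd 1 (profileHeight Ψ))) ![0, t]
        + ((1 + τ ^ 2 * r ^ 2) * deriv (profileField κ Ψ) t ^ 2
          - profileField κ Ψ t ^ 2 / bigR κ r ^ 2) / (4 * bigR κ r) := by
  have hR := bigR_pos hr hκ
  have hO := hΨ.isOpen_profileDomain
  have hY := hΨ.contDiffOn_profileArea
  have hz := hΨ.contDiffOn_profileHeight
  have hZ := contDiffOn_pd hO hz 1
  have hT := contDiffOn_pd hO hY 1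
  have hZ1 := hΨ.pd_one_profileHeight_start hδ hκ t
  have hZ0 := hΨ.pd_zero_pd_one_profileHeight hδ hL hκ ht
  have hT0 := hΨ.pd_one_profileArea_start hδ hκ t
  have hD : ContDiffOn ℝ ∞ (fun x => Real.sqrt (profileDensitySq κ τ Ψ x)) U :=
    (hΨ.contDiffOn_profileDensitySq.mono hUs).sqrt fun x hx => (hpos x hx).ne'
  obtain ⟨h1, h2⟩ := pd_pd_density hU (hY.mono hUs) (hZ.mono hUs) (hT.mono hUs)
    (hΨ.contDiffOn_profileSq.mono hUs) hD
    (fun y hy => Real.mul_self_sqrt (hpos y hy).le) hx hZ1 hZ0 hT0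
  have h3 := pd_volume hO hY hZ hT hz (hUs hx) hZ1 hZ0 hT0 (hΨ.pd_zero_profileHeight_start hδ ht)
  have h3' : pd 0 (profileVolume κ Ψ) ![0, t] = pd 0 (pd 0 (profileArea κ Ψ)) ![0, t] / 2 := h3
  rw [h3']
  rw [hΨ.profileDensitySq_start hδ hκ, Real.sqrt_sq hR.le, hΨ.profileArea_start] at h1 h2
  rw [hΨ.profileSq_start, hΨ.pd_zero_pd_one_profileArea hδ hκ] at h2
  change 2 * bigR κ r * _ = _ * profileField κ Ψ t at h1
  change _ = _ - κ / 2 * profileField κ Ψ t ^ 2 + _ + _ at h2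
  have hm : 1 - κ / 2 * (r * bigR κ r) = 2 * bigR κ r * ((4 - κ * r ^ 2) / (8 * r)) := by
    rw [bigR]; field_simp; ring
  have hq : r * bigR κ r - κ / 4 * (r * bigR κ r) ^ 2 = bigR κ r ^ 2 := by
    rw [bigR]; field_simp; ring
  -- This is k² + κ = 1/R² again, with k = -2H the geodesic curvature of α; it produces the
  -- coefficient of a².
  have hone : κ * bigR κ r ^ 2 + (2 * bigR κ r * ((4 - κ * r ^ 2) / (8 * r))) ^ 2 = 1 := by
    rw [bigR]; field_simp; ring
  rw [hm] at h1 h2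
  rw [hq] at h2
  generalize (4 - κ * r ^ 2) / (8 * r) = H at *
  generalize bigR κ r = R at *
  generalize profileField κ Ψ t = a at *
  generalize deriv (profileField κ Ψ) t = a' at *
  generalize pd 0 (pd 0 (profileArea κ Ψ)) ![0, t] = b at *
  generalize pd 0 (pd 0 (pd 1 (profileHeight Ψ))) ![0, t] = c at *
  generalize pd 0 (pd 0 fun x => Real.sqrt (profileDensitySq κ τ Ψ x)) ![0, t] = d at *
  have hD1 : pd 0 (fun x => Real.sqrt (profileDensitySq κ τ Ψ x)) ![0, t] = H * a := by
    have : 2 * R ≠ 0 := by positivity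
    apply mul_left_cancel₀ this
    linear_combination h1
  rw [hD1] at h2
  field_simp
  linear_combination 2 * R ^ 2 * h2 - a ^ 2 * hone

/-- The second variation of `A + 2HV`, in terms of the variation field of the enclosed area. -/
lemma second_variation (hΨ : IsAxialVariation κ τ r L δ Ψ) (hδ : 0 < δ) (hr : 0 < r)
    (hκ : 0 < 4 + κ * r ^ 2) (hL : 0 < L) :
    iteratedDeriv 2 (fun e => area κ τ r L Ψ e
      + 2 * (-((4 - κ * r ^ 2) / (8 * r))) * sweptVolume κ τ r L Ψ e) 0
      = Real.pi / (2 * bigR κ r) * profileForm κ τ r L (profileField κ Ψ) := by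
  have hR := bigR_pos hr hκ
  have hO := hΨ.isOpen_profileDomain
  have h0 : (0 : ℝ) ∈ Ioo (-δ) δ := ⟨by linarith, hδ⟩
  set D : (Fin 2 → ℝ) → ℝ := fun x => Real.sqrt (profileDensitySq κ τ Ψ x) with hDdef
  -- The square root is smooth where W > 0. This open set contains the slice e = 0, where W = R²,
  -- and hence all nearby slices.
  set U : Set (Fin 2 → ℝ) := profileDomain κ δ Ψ ∩ profileDensitySq κ τ Ψ ⁻¹' Ioi 0
  have hU : IsOpen U :=
    hΨ.contDiffOn_profileDensitySq.continuousOn.isOpen_inter_preimage hO isOpen_Ioi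
  have hUs : U ⊆ profileDomain κ δ Ψ := inter_subset_left
  have hD : ContDiffOn ℝ ∞ D U :=
    (hΨ.contDiffOn_profileDensitySq.mono hUs).sqrt fun x hx => ne_of_gt hx.2
  have hB := hΨ.contDiffOn_profileVolume
  have hmem : ∀ t ∈ Icc 0 L, ![0, t] ∈ U := fun t ht => ⟨hΨ.mem_profileDomain h0 ht, by
    rw [mem_preimage, hΨ.profileDensitySq_start hδ hκ]; exact pow_pos hR 2⟩
  have hfirst : ∀ᶠ e in nhds (0 : ℝ), HasDerivAt (fun e => area κ τ r L Ψ e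
      + 2 * (-((4 - κ * r ^ 2) / (8 * r))) * sweptVolume κ τ r L Ψ e)
      (2 * Real.pi * (∫ t in (0 : ℝ)..L, pd 0 D ![e, t])
        + 2 * (-((4 - κ * r ^ 2) / (8 * r)))
          * (2 * Real.pi * ∫ t in (0 : ℝ)..L, profileVolume κ Ψ ![e, t])) e := by
    filter_upwards [eventually_slice_subset hU hmem, isOpen_Ioo.mem_nhds h0] with e he he'
    have h1 : HasDerivAt (area κ τ r L Ψ) (2 * Real.pi * ∫ t in (0 : ℝ)..L, pd 0 D ![e, t]) e := by
      refine ((hasDerivAt_integral_slice hL.le hU hD he).const_mul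
        (2 * Real.pi)).congr_of_eventuallyEq ?_
      filter_upwards [isOpen_Ioo.mem_nhds he'] with x hx using hΨ.area_eq hL.le hR hx
    exact h1.add ((hΨ.hasDerivAt_sweptVolume hL hR he').const_mul _)
  have hsecond := ((hasDerivAt_integral_slice hL.le hU (contDiffOn_pd hU hD 0) hmem).const_mul
    (2 * Real.pi)).add (((hasDerivAt_integral_slice hL.le hO hB
      fun t ht => hΨ.mem_profileDomain h0 ht).const_mul (2 * Real.pi)).const_mul
        (2 * (-((4 - κ * r ^ 2) / (8 * r)))))
  have hderiv := (hsecond.congr_of_eventuallyEq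
    (hfirst.mono fun e he => he.deriv)).deriv
  rw [iteratedDeriv_succ, iteratedDeriv_one, hderiv]
  have hslice {f : (Fin 2 → ℝ) → ℝ} {V : Set (Fin 2 → ℝ)} (hf : ContDiffOn ℝ ∞ f V)
      (hV : ∀ t ∈ Icc 0 L, ![0, t] ∈ V) :
      IntervalIntegrable (fun t => f ![0, t]) MeasureTheory.volume 0 L := by
    apply ContinuousOn.intervalIntegrable
    rw [uIcc_of_le hL.le]
    exact continuousOn_slice hf.continuousOn hV
  have hmemO : ∀ t ∈ Icc 0 L, ![0, t] ∈ profileDomain κ δ Ψ :=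
    fun t ht => hΨ.mem_profileDomain h0 ht
  have hv := hΨ.contDiff_profileField hδ hκ
  have hvc := hv.continuous
  have hvc' : Continuous (deriv (profileField κ Ψ)) := (hv.iterate_deriv 1).continuous
  have hint : (∫ t in (0 : ℝ)..L, pd 0 (pd 0 D) ![0, t])
      + 2 * (-((4 - κ * r ^ 2) / (8 * r))) * (∫ t in (0 : ℝ)..L, pd 0 (profileVolume κ Ψ) ![0, t])
      = bigR κ r * (∫ t in (0 : ℝ)..L, pd 0 (pd 0 (pd 1 (profileHeight Ψ))) ![0, t])
        + profileForm κ τ r L (profileField κ Ψ) / (4 * bigR κ r) := by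
    have hform : profileForm κ τ r L (profileField κ Ψ) / (4 * bigR κ r)
        = ∫ t in (0 : ℝ)..L, ((1 + τ ^ 2 * r ^ 2) * deriv (profileField κ Ψ) t ^ 2
          - profileField κ Ψ t ^ 2 / bigR κ r ^ 2) / (4 * bigR κ r) := by
      rw [intervalIntegral.integral_div, intervalIntegral.integral_sub,
        intervalIntegral.integral_const_mul, intervalIntegral.integral_div, profileForm]
      all_goals exact Continuous.intervalIntegrable (by fun_prop) _ _
    rw [hform, ← intervalIntegral.integral_const_mul, ← intervalIntegral.integral_const_mul,
      ← intervalIntegral.integral_add, ← intervalIntegral.integral_add]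
    · refine intervalIntegral.integral_congr fun t ht => ?_
      rw [uIcc_of_le hL.le] at ht
      exact hΨ.second_derivative_integrand hδ hr hκ hL hU hUs (fun x hx => hx.2) ht (hmem t ht)
    · exact (hslice (contDiffOn_pd hO (contDiffOn_pd hO (contDiffOn_pd hO
        hΨ.contDiffOn_profileHeight 1) 0) 0) hmemO).const_mul _
    · exact Continuous.intervalIntegrable (by fun_prop) _ _
    · exact hslice (contDiffOn_pd hU (contDiffOn_pd hU hD 0) 0) hmem
    · exact (hslice (contDiffOn_pd hO hB 0) hmemO).const_mul _
  rw [hΨ.integral_pd_pd_height hδ hL, mul_zero, zero_add] at hint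
  have e : Real.pi / (2 * bigR κ r) * profileForm κ τ r L (profileField κ Ψ)
      = 2 * Real.pi * (profileForm κ τ r L (profileField κ Ψ) / (4 * bigR κ r)) := by
    field_simp; ring
  rw [e, ← hint]
  ring

end IsAxialVariation

end SecondVariation

/-! ## Variations with prescribed variation field -/

section Realization

/-- The squared coordinate radius of the circle which encloses the area `π (r R + a)`. -/
def sqRadius (κ r a : ℝ) : ℝ := 4 * (r * bigR κ r + a) / (4 - κ * (r * bigR κ r + a))

/-- The variation of the cylinder for which the area enclosed at height `t` is
`π (r R + e v(t))`. -/
def areaVariation (κ r : ℝ) (v : ℝ → ℝ) (e : ℝ) (q : Fin 2 → ℝ) : Fin 3 → ℝ :=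
  triple (Real.sqrt (sqRadius κ r (e * v (q 1))) * Real.cos (q 0 / bigR κ r))
    (Real.sqrt (sqRadius κ r (e * v (q 1))) * Real.sin (q 0 / bigR κ r)) (q 1)

/-- A range of parameters on which `areaVariation` is a variation, if `|v| ≤ 1`. -/
def areaBound (κ r : ℝ) : ℝ :=
  min (r * bigR κ r) ((4 - κ * (r * bigR κ r)) / (|κ| + 1))

variable {κ τ r L : ℝ} {v : ℝ → ℝ}

/-- The relation Y = 4P/(4 + κP) inverts to P = 4Y/(4 - κY), with (4 + κP)(4 - κY) = 16. Staying in
the model therefore means keeping 4 - κY positive. -/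
lemma four_sub_pos (hκ : 0 < 4 + κ * r ^ 2) : 0 < 4 - κ * (r * bigR κ r) := by
  have : 4 - κ * (r * bigR κ r) = 16 / (4 + κ * r ^ 2) := by rw [bigR]; field_simp; ring
  rw [this]; positivity

lemma areaBound_pos (hr : 0 < r) (hκ : 0 < 4 + κ * r ^ 2) : 0 < areaBound κ r :=
  lt_min (mul_pos hr (bigR_pos hr hκ)) (div_pos (four_sub_pos hκ) (by positivity))

lemma area_pos {a : ℝ} (ha : |a| < areaBound κ r) : 0 < r * bigR κ r + a := by
  have := (abs_lt.1 (ha.trans_le (min_le_left _ _))).1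
  linarith

lemma four_sub_area_pos {a : ℝ} (ha : |a| < areaBound κ r) :
    0 < 4 - κ * (r * bigR κ r + a) := by
  have h := ha.trans_le (min_le_right _ _)
  rw [lt_div_iff₀ (by positivity)] at h
  have h1 : κ * a ≤ |a| * |κ| := by
    rw [← abs_mul, mul_comm a]; exact le_abs_self _
  nlinarith [abs_nonneg a]

lemma sqRadius_pos {a : ℝ} (ha : |a| < areaBound κ r) : 0 < sqRadius κ r a :=
  div_pos (by linarith [area_pos ha]) (four_sub_area_pos ha)

lemma four_add_sqRadius {a : ℝ} (ha : |a| < areaBound κ r) :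
    4 + κ * sqRadius κ r a = 16 / (4 - κ * (r * bigR κ r + a)) := by
  have := (four_sub_area_pos ha).ne'
  rw [sqRadius]; field_simp; ring

lemma sqRadius_zero (hκ : 0 < 4 + κ * r ^ 2) : sqRadius κ r 0 = r ^ 2 := by
  have : 4 - κ * (r * bigR κ r) = 16 / (4 + κ * r ^ 2) := by rw [bigR]; field_simp; ring
  rw [sqRadius, add_zero, this, bigR]
  have hne := hκ.ne'
  generalize 4 + κ * r ^ 2 = D at *
  field_simp
  ring

lemma abs_mul_lt {e b c : ℝ} (he : e ∈ Ioo (-b) b) (hc : |c| ≤ 1) : |e * c| < b := by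
  rw [abs_mul]
  have := abs_lt.2 he
  nlinarith [abs_nonneg e, abs_nonneg c]

lemma contDiffOn_sqrt_sqRadius :
    ContDiffOn ℝ ∞ (fun a => Real.sqrt (sqRadius κ r a)) {a | |a| < areaBound κ r} := by
  refine ContDiffOn.sqrt ?_ fun a ha => (sqRadius_pos ha).ne'
  exact ContDiffOn.div (by fun_prop) (by fun_prop) fun a ha => (four_sub_area_pos ha).ne'

lemma isAxialVariation_areaVariation (hr : 0 < r) (hκ : 0 < 4 + κ * r ^ 2)
    (hv : ContDiff ℝ ∞ v) (hv1 : ∀ t, |v t| ≤ 1) (h0 : v 0 = 0) (hL : v L = 0) :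
    IsAxialVariation κ τ r L (areaBound κ r) (areaVariation κ r v) := by
  have hsq0 : Real.sqrt (sqRadius κ r 0) = r := by
    rw [sqRadius_zero hκ, Real.sqrt_sq hr.le]
  have hcyl : ∀ (e : ℝ) (q : Fin 2 → ℝ), e * v (q 1) = 0 →
      areaVariation κ r v e q = cylinder κ r q := by
    intro e q h
    rw [areaVariation, h, hsq0]
    funext k
    revert k
    rw [forall_fin_three]
    exact ⟨rfl, rfl, rfl⟩
  refine ⟨?_, ?_, ?_, ?_, ?_, ?_, ?_⟩
  · have hq (i : Fin 2) : ContDiff ℝ ∞ fun p : ℝ × (Fin 2 → ℝ) => p.2 i :=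
      (contDiff_apply ℝ ℝ i).comp contDiff_snd
    have hs : ContDiffOn ℝ ∞
        (fun p : ℝ × (Fin 2 → ℝ) => Real.sqrt (sqRadius κ r (p.1 * v (p.2 1))))
        (Ioo (-areaBound κ r) (areaBound κ r) ×ˢ univ) :=
      contDiffOn_sqrt_sqRadius.comp (contDiff_fst.mul (hv.comp (hq 1))).contDiffOn
        fun p hp => abs_mul_lt hp.1 (hv1 _)
    rw [contDiffOn_pi, forall_fin_three]
    exact ⟨hs.mul (Real.contDiff_cos.comp ((hq 0).div_const _)).contDiffOn,
      hs.mul (Real.contDiff_sin.comp ((hq 0).div_const _)).contDiffOn, (hq 1).contDiffOn⟩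
  · intro e he s t _
    have ha := abs_mul_lt he (hv1 t)
    have hP := Real.sq_sqrt (sqRadius_pos ha).le
    change 0 < 4 + κ * ((Real.sqrt (sqRadius κ r (e * v t)) * Real.cos (s / bigR κ r)) ^ 2
      + (Real.sqrt (sqRadius κ r (e * v t)) * Real.sin (s / bigR κ r)) ^ 2)
    rw [mul_pow, mul_pow, hP, ← mul_add, Real.cos_sq_add_sin_sq, mul_one, four_add_sqRadius ha]
    exact div_pos (by norm_num) (four_sub_area_pos ha)
  · intro q
    exact hcyl 0 q (zero_mul _)
  · intro e _ s
    exact hcyl e _ (by simp [h0])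
  · intro e _ s
    exact hcyl e _ (by simp [hL])
  · intro s t _
    have hpos := areaBound_pos hr hκ
    have hopen : IsOpen {a : ℝ | |a| < areaBound κ r} := isOpen_lt continuous_abs continuous_const
    have hd : DifferentiableAt ℝ (fun a => Real.sqrt (sqRadius κ r a)) (0 * v t) :=
      (contDiffOn_sqrt_sqRadius.contDiffAt (hopen.mem_nhds (by simpa using hpos))).differentiableAt
        (by simp)
    have hd' := hd.hasDerivAt.comp (0 : ℝ) ((hasDerivAt_id (0 : ℝ)).mul_const (v t))
    set d := deriv (fun a => Real.sqrt (sqRadius κ r a)) (0 * v t) * (1 * v t)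
    have hderiv : HasDerivAt (fun e => areaVariation κ r v e ![s, t])
        (triple (d * Real.cos (s / bigR κ r)) (d * Real.sin (s / bigR κ r)) 0) 0 := by
      rw [hasDerivAt_pi, forall_fin_three]
      exact ⟨hd'.mul_const _, hd'.mul_const _, hasDerivAt_const _ _⟩
    -- The variation moves points radially with coordinate speed d, and N is radial of coordinate
    -- length σ⁻¹, whence the factor σ.
    refine ⟨d * (4 / (4 + κ * r ^ 2)), ?_⟩
    rw [hderiv.deriv]
    funext k
    revert k
    simp only [forall_fin_three, Pi.smul_apply, smul_eq_mul, cylinderNormal_zero,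
      cylinderNormal_one, cylinderNormal_two, triple_zero, triple_one, triple_two, mul_zero,
      Matrix.cons_val_zero, and_true]
    have : 4 / (4 + κ * r ^ 2) ≠ 0 := by positivity
    constructor <;> field_simp
  · intro e _ s c t
    funext k
    revert k
    rw [forall_fin_three, rotation_apply_zero, rotation_apply_one, rotation_apply_two]
    simp only [areaVariation, triple_zero, triple_one, triple_two, Matrix.cons_val_zero,
      Matrix.cons_val_one, Matrix.cons_val_fin_one, add_div, Real.cos_add, Real.sin_add, and_true]
    constructor <;> ring

lemma profileArea_areaVariation {e : ℝ} (he : e ∈ Ioo (-areaBound κ r) (areaBound κ r))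
    (hv1 : ∀ t, |v t| ≤ 1) (t : ℝ) :
    profileArea κ (areaVariation κ r v) ![e, t] = r * bigR κ r + e * v t := by
  have ha := abs_mul_lt he (hv1 t)
  have hP : profileSq (areaVariation κ r v) ![e, t] = sqRadius κ r (e * v t) := by
    change (Real.sqrt (sqRadius κ r (e * v t)) * Real.cos (0 / bigR κ r)) ^ 2
      + (Real.sqrt (sqRadius κ r (e * v t)) * Real.sin (0 / bigR κ r)) ^ 2 = _
    rw [mul_pow, mul_pow, Real.sq_sqrt (sqRadius_pos ha).le]
    simp
  have hσ : sigma κ (profileCurve (areaVariation κ r v) ![e, t])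
      = 4 / (4 + κ * profileSq (areaVariation κ r v) ![e, t]) := rfl
  rw [profileArea, hσ, hP, four_add_sqRadius ha, sqRadius]
  have := (four_sub_area_pos ha).ne'
  field_simp
  norm_num

lemma pd_zero_profileArea_areaVariation (hr : 0 < r) (hκ : 0 < 4 + κ * r ^ 2)
    (hv : ContDiff ℝ ∞ v) (hv1 : ∀ t, |v t| ≤ 1) (h0 : v 0 = 0) (hL : v L = 0)
    {e : ℝ} (he : e ∈ Ioo (-areaBound κ r) (areaBound κ r)) {t : ℝ} (ht : t ∈ Icc 0 L) :
    pd 0 (profileArea κ (areaVariation κ r v)) ![e, t] = v t := by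
  -- The enclosed area does not involve τ, so any value serves.
  have hΨ := isAxialVariation_areaVariation (τ := 0) hr hκ hv hv1 h0 hL
  have h := hasDerivAt_fst (differentiableAt_of_contDiffOn hΨ.isOpen_profileDomain
    hΨ.contDiffOn_profileArea (hΨ.mem_profileDomain he ht))
  have h2 : HasDerivAt (fun x => r * bigR κ r + x * v t) (1 * v t) e :=
    ((hasDerivAt_id e).mul_const (v t)).const_add _
  rw [one_mul] at h2
  refine (h.congr_of_eventuallyEq ?_).unique h2
  filter_upwards [isOpen_Ioo.mem_nhds he] with x hx
    using (profileArea_areaVariation hx hv1 t).symm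

/-- Here Y_e = v and z = t for every e, so the volume density is v/2 throughout, not only at e = 0.
-/
lemma sweptVolume_areaVariation (hr : 0 < r) (hκ : 0 < 4 + κ * r ^ 2) (hLpos : 0 < L)
    (hv : ContDiff ℝ ∞ v) (hv1 : ∀ t, |v t| ≤ 1) (h0 : v 0 = 0) (hL : v L = 0)
    (hmean : ∫ t in (0 : ℝ)..L, v t = 0) {e : ℝ}
    (he : e ∈ Ioo (-areaBound κ r) (areaBound κ r)) :
    sweptVolume κ τ r L (areaVariation κ r v) e = 0 := by
  have hΨ := isAxialVariation_areaVariation (τ := τ) hr hκ hv hv1 h0 hL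
  have hpos := areaBound_pos hr hκ
  have hheight (i : Fin 2) (x : Fin 2 → ℝ) :
      pd i (profileHeight (areaVariation κ r v)) x = if 1 = i then 1 else 0 :=
    pd_coord i 1 x
  rw [hΨ.sweptVolume_eq hLpos.le (bigR_pos hr hκ) he]
  have hz : ∀ h ∈ uIcc 0 e,
      ∫ t in (0 : ℝ)..L, profileVolume κ (areaVariation κ r v) ![h, t] = 0 := by
    intro h hh
    have hh' : h ∈ Ioo (-areaBound κ r) (areaBound κ r) :=
      ordConnected_Ioo.uIcc_subset ⟨by linarith, hpos⟩ he hh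
    rw [intervalIntegral.integral_congr (g := fun t => v t * (1 / 2)),
      intervalIntegral.integral_mul_const, hmean, zero_mul]
    intro t ht
    rw [uIcc_of_le hLpos.le] at ht
    simp only [profileVolume, hheight,
      pd_zero_profileArea_areaVariation hr hκ hv hv1 h0 hL hh' ht, reduceIte, Fin.reduceEq]
    ring
  rw [intervalIntegral.integral_congr (g := fun _ => 0) hz]
  simp

lemma profileForm_profileField_areaVariation (hr : 0 < r) (hκ : 0 < 4 + κ * r ^ 2) (hLpos : 0 < L)
    (hv : ContDiff ℝ ∞ v) (hv1 : ∀ t, |v t| ≤ 1) (h0 : v 0 = 0) (hL : v L = 0) :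
    profileForm κ τ r L (profileField κ (areaVariation κ r v)) = profileForm κ τ r L v := by
  have hΨ := isAxialVariation_areaVariation (τ := τ) hr hκ hv hv1 h0 hL
  have hpos := areaBound_pos hr hκ
  have heq : ∀ t ∈ Icc 0 L, profileField κ (areaVariation κ r v) t = v t := fun t ht =>
    pd_zero_profileArea_areaVariation hr hκ hv hv1 h0 hL ⟨by linarith, hpos⟩ ht
  have hw := hΨ.contDiff_profileField hpos hκ
  -- The two functions are compared only on [0, L], so one-sided derivatives settle the end points.
  have heq' : ∀ t ∈ Icc 0 L, deriv (profileField κ (areaVariation κ r v)) t = deriv v t := by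
    intro t ht
    have h1 := ((hw.differentiable (by simp) t).hasDerivAt).hasDerivWithinAt (s := Icc 0 L)
    have h2 := ((hv.differentiable (by simp) t).hasDerivAt).hasDerivWithinAt (s := Icc 0 L)
    exact (uniqueDiffOn_Icc hLpos t ht).eq_deriv _ h1 (h2.congr heq (heq t ht))
  rw [profileForm, profileForm]
  congr 2
  · refine intervalIntegral.integral_congr fun t ht => ?_
    rw [uIcc_of_le hLpos.le] at ht
    simp only [heq' t ht]
  · refine intervalIntegral.integral_congr fun t ht => ?_
    rw [uIcc_of_le hLpos.le] at ht
    simp only [heq t ht]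

end Realization

/-! ## Stability -/

section Stability

variable {κ τ r L : ℝ}

lemma sin_profile (hL : 0 < L) (k : ℕ) :
    ContDiff ℝ ∞ (fun t => Real.sin (k * Real.pi / L * t)) ∧
    (∀ t, |Real.sin (k * Real.pi / L * t)| ≤ 1) ∧
    Real.sin (k * Real.pi / L * 0) = 0 ∧ Real.sin (k * Real.pi / L * L) = 0 :=
  ⟨contDiff_sin_mul _, fun _ => Real.abs_sin_le_one _, by simp, sin_pi_div_mul hL k⟩

lemma formStronglyStable_iff_le (hr : 0 < r) (hκ : 0 < 4 + κ * r ^ 2) (hL : 0 < L) :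
    FormStronglyStable κ τ r L ↔ L ≤ profileLength κ τ r / 2 := by
  rw [formStronglyStable_iff hr hκ]
  refine ⟨fun h => ?_, fun h v hv h0 h1 => profileForm_nonneg hr hκ hL h hv h0 h1⟩
  by_contra! hlt
  obtain ⟨hv, -, h0, h1⟩ := sin_profile hL 1
  exact (profileForm_sin_neg hr hκ hL one_pos (by simpa using hlt)).not_ge (h _ hv h0 h1)

lemma formStable_iff_le (hr : 0 < r) (hκ : 0 < 4 + κ * r ^ 2) (hL : 0 < L) :
    FormStable κ τ r L ↔ L ≤ profileLength κ τ r := by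
  rw [formStable_iff hr hκ]
  refine ⟨fun h => ?_, fun h v hv h0 h1 hm =>
    profileForm_nonneg_of_mean_zero hr hκ hL h hv h0 h1 hm⟩
  by_contra! hlt
  obtain ⟨hv, -, h0, h1⟩ := sin_profile hL 2
  exact (profileForm_sin_neg hr hκ hL two_pos (by simpa using hlt)).not_ge
    (h _ hv h0 h1 (integral_sin_two_pi_div hL))

lemma stronglyStable_iff_le (hr : 0 < r) (hκ : 0 < 4 + κ * r ^ 2) (hL : 0 < L) :
    StronglyStable κ τ r L ↔ L ≤ profileLength κ τ r / 2 := by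
  have hR := bigR_pos hr hκ
  have hc : 0 < Real.pi / (2 * bigR κ r) := by positivity
  constructor
  · rintro ⟨H, hH, h⟩
    -- The mean curvature at one point already determines H.
    obtain rfl : -((4 - κ * r ^ 2) / (8 * r)) = H :=
      (meanCurvature_cylinder hr hκ 0).symm.trans (hH 0)
    by_contra! hlt
    obtain ⟨hv, hv1, h0, h1⟩ := sin_profile hL 1
    have hΨ := isAxialVariation_areaVariation (τ := τ) hr hκ hv hv1 h0 h1
    have hpos := areaBound_pos hr hκ
    have h2 := h _ _ hpos hΨ
    rw [hΨ.second_variation hpos hr hκ hL,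
      profileForm_profileField_areaVariation hr hκ hL hv hv1 h0 h1] at h2
    exact (profileForm_sin_neg hr hκ hL one_pos (by simpa using hlt)).not_ge
      (nonneg_of_mul_nonneg_right h2 hc)
  · intro h
    refine ⟨_, meanCurvature_cylinder hr hκ, fun δ Ψ hδ hΨ => ?_⟩
    rw [hΨ.second_variation hδ hr hκ hL]
    exact mul_nonneg hc.le (profileForm_nonneg hr hκ hL h (hΨ.contDiff_profileField hδ hκ)
      (hΨ.profileField_eq_zero hδ hκ fun e he => hΨ.bottom e he 0)
      (hΨ.profileField_eq_zero hδ hκ fun e he => hΨ.top e he 0))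

lemma IsAxialVariation.second_variation_of_volume_preserving {δ : ℝ}
    {Ψ : ℝ → (Fin 2 → ℝ) → (Fin 3 → ℝ)} (hΨ : IsAxialVariation κ τ r L δ Ψ) (hδ : 0 < δ)
    (hr : 0 < r) (hκ : 0 < 4 + κ * r ^ 2) (hL : 0 < L)
    (hvol : ∀ e ∈ Ioo (-δ) δ, sweptVolume κ τ r L Ψ e = 0) :
    iteratedDeriv 2 (area κ τ r L Ψ) 0
      = Real.pi / (2 * bigR κ r) * profileForm κ τ r L (profileField κ Ψ) := by
  rw [← hΨ.second_variation hδ hr hκ hL]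
  refine Filter.EventuallyEq.iteratedDeriv_eq 2 ?_
  filter_upwards [isOpen_Ioo.mem_nhds (show (0 : ℝ) ∈ Ioo (-δ) δ from ⟨by linarith, hδ⟩)] with e he
  rw [hvol e he, mul_zero, add_zero]

lemma stable_iff_le (hr : 0 < r) (hκ : 0 < 4 + κ * r ^ 2) (hL : 0 < L) :
    Stable κ τ r L ↔ L ≤ profileLength κ τ r := by
  have hR := bigR_pos hr hκ
  have hc : 0 < Real.pi / (2 * bigR κ r) := by positivity
  constructor
  · intro h
    by_contra! hlt
    -- The second sine has mean zero, so its variation is admissible.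
    obtain ⟨hv, hv1, h0, h1⟩ := sin_profile hL 2
    have hΨ := isAxialVariation_areaVariation (τ := τ) hr hκ hv hv1 h0 h1
    have hpos := areaBound_pos hr hκ
    have hvol : ∀ e ∈ Ioo (-areaBound κ r) (areaBound κ r), sweptVolume κ τ r L
        (areaVariation κ r fun t => Real.sin ((2 : ℕ) * Real.pi / L * t)) e = 0 := fun e he =>
      sweptVolume_areaVariation hr hκ hL hv hv1 h0 h1 (integral_sin_two_pi_div hL) he
    have h2 := h _ _ hpos hΨ hvol
    rw [hΨ.second_variation_of_volume_preserving hpos hr hκ hL hvol,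
      profileForm_profileField_areaVariation hr hκ hL hv hv1 h0 h1] at h2
    exact (profileForm_sin_neg hr hκ hL two_pos (by simpa using hlt)).not_ge
      (nonneg_of_mul_nonneg_right h2 hc)
  · intro h δ Ψ hδ hΨ hvol
    rw [hΨ.second_variation_of_volume_preserving hδ hr hκ hL hvol]
    refine mul_nonneg hc.le (profileForm_nonneg_of_mean_zero hr hκ hL h
      (hΨ.contDiff_profileField hδ hκ)
      (hΨ.profileField_eq_zero hδ hκ fun e he => hΨ.bottom e he 0)
      (hΨ.profileField_eq_zero hδ hκ fun e he => hΨ.top e he 0) ?_)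
    -- The volume vanishes identically near 0, so V'(0) = π ∫ a is zero and the field has mean zero.
    have hV := (hΨ.hasDerivAt_sweptVolume_zero hδ hL hκ hR).congr_of_eventuallyEq
      (f₁ := fun _ => 0) (by
        filter_upwards [isOpen_Ioo.mem_nhds
          (show (0 : ℝ) ∈ Ioo (-δ) δ from ⟨by linarith, hδ⟩)] with e he using (hvol e he).symm)
    exact (mul_eq_zero.1 (hV.unique (hasDerivAt_const _ _))).resolve_left Real.pi_pos.ne'

end Stability

end EKT

end

theorem corollary4p1 (κ τ r L : ℝ) (hr : 0 < r) (hκ : 0 < 4 + κ * r ^ 2) (hL : 0 < L) :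
    ((EKT.StronglyStable κ τ r L ↔ L ≤ EKT.criticalLength κ τ (EKT.radius κ r) / 2) ∧
      (EKT.FormStronglyStable κ τ r L ↔
        L ≤ EKT.criticalLength κ τ (EKT.radius κ r) / 2)) ∧
    ((EKT.Stable κ τ r L ↔ L ≤ EKT.criticalLength κ τ (EKT.radius κ r)) ∧
      (EKT.FormStable κ τ r L ↔ L ≤ EKT.criticalLength κ τ (EKT.radius κ r))) := by
  rw [EKT.criticalLength_eq hr hκ]
  exact ⟨⟨EKT.stronglyStable_iff_le hr hκ hL, EKT.formStronglyStable_iff_le hr hκ hL⟩,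
    EKT.stable_iff_le hr hκ hL, EKT.formStable_iff_le hr hκ hL⟩
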